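/- **Continuity of the merge tree on spaces of piecewise polynomial functions.** Let $x_0<x_1<\dots<x_n$ be a finite grid of knots, let $d\ge 0$, and let $S$ be any set of functions $f:[x_0,x_n]\to\mathbb R$ that are piecewise polynomial of degree at most $d$ on this grid, i.e. on each open interval $(x_i,x_{i+1})$ the function $f$ agrees with a polynomial of degree at most $d$. Assume that every $f\in S$ is continuous or, more generally, regular in the sense defined below. Then every $f\in S$ has a merge tree $T_f$, and the map $f\mapsto T_f$ is continuous from $S$ with the sup-norm to merge trees with the edit distance $d_E$: for every $f\in S$ and $\varepsilon>0$ there is $\delta>0$ such that for every $g\in S$ with $|f(y)-g(y)|<\delta$ for all $y\in[x_0,x_n]$, and every truncation height $K$ larger than all finite heights of $T_f$ and of $T_g$, $$d_E(T_f,T_g)<\varepsilon ,$$ where $d_E$ is computed after truncating both trees at height $K$. *Merge trees of functions.* For $f:X\to\mathbb R$ let $X_t=\{f\le t\}$ and let $\pi_0(X_t)$ be its set of path components; for $t\le t'$ the inclusion induces a map $\pi_0(X_t)\to\pi_0(X_{t'})$. A finite set $C\subset\mathbb R$ is *critical* if this map is bijective whenever $t\le t'$ and $[t,t']\cap C=\emptyset$;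 the elements $t_1<\dots<t_m$ of the smallest critical set are the *critical values*. The function $f$ is *tame* if a finite critical set exists and every $\pi_0(X_t)$ is finite, and *regular* if for each critical value $t_j$ the map $\pi_0(X_{t_j})\to\pi_0(X_{t_j+\varepsilon})$ is bijective for all small $\varepsilon>0$. We say that $f$ *has a merge tree* if $X$ is path connected and $f$ is tame, regular and bounded. The vertices of $T_f$ are then a root, of height $+\infty$, and, at height $t_j$ for each critical value $t_j$, the components $U\in\pi_0(X_{t_j})$ that contain either no component of $X_{t_{j-1}}$ (for $j=1$, all components of $X_{t_1}$) or at least two of them. The father of a vertex is the lowest vertex of larger height whose component contains its component, or the root if there is none. The result is a finite rooted tree whose root has order one, with a strictly increasing height function; it is considered up to isomorphism. *Edit distance.* Truncating at height $K$ replaces the height $+\infty$ of the root by $K$ and gives each edge the difference of the heights of its endpoints as weight, so that one obtains a finite rooted tree with positive edge weights. The *edits* of such trees are: shrinking (changing the weight of one edge to another positive value), at a cost equal to the absolute difference of the two weights; deleting an edge together with its lower vertex, whose children are attached to its father, and the inverse operation, insertion, at a cost equal to the weight of the edge; ghosting a non-root vertex that has exactly one child, i.e. joining its two edges and adding their weights,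 and the inverse operation, splitting, at cost $0$. The distance $d_E(T,T')$ is the infimum of the total costs of the finite sequences of edits that lead from $T$ to $T'$. -/

import Mathlib

open Set

namespace MergeTrees

/-! ### Sublevel sets and their path components -/

section Sublevel

variable {X : Type} [TopologicalSpace X]

/-- The sublevel set `X_t = f⁻¹((-∞, t])`. -/
def sublevel {X : Type} (f : X → ℝ) (t : ℝ) : Set X := {x | f x ≤ t}

/-- `π₀(X_t)`, the set of path components of the sublevel set `X_t`, as subsets of `X`. -/
def comps (f : X → ℝ) (t : ℝ) : Set (Set X) :=
  {U | ∃ x ∈ sublevel f t, U = pathComponentIn (sublevel f t) x}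

/-- For `t ≤ t'`, the map `π₀(X_t) → π₀(X_{t'})` induced by the inclusion sends `U` to the unique
`V ∈ π₀(X_{t'})` with `U ⊆ V`. This predicate says that the map is bijective: every
`V ∈ π₀(X_{t'})` contains exactly one `U ∈ π₀(X_t)`. -/
def InclBijective (f : X → ℝ) (t t' : ℝ) : Prop :=
  ∀ V ∈ comps f t', ∃! U, U ∈ comps f t ∧ U ⊆ V

/-- `C` is a critical set: the inclusion-induced maps between two levels that lie in the same
component of `ℝ \ C` are bijective. -/
def IsCriticalSet (f : X → ℝ) (C : Finset ℝ) : Prop :=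
  ∀ t t', t ≤ t' → (∀ c ∈ C, c ∉ Icc t t') → InclBijective f t t'

/-- The critical values of `f`, that is, the smallest critical set. -/
def criticalValues (f : X → ℝ) : Set ℝ :=
  {t | ∀ C : Finset ℝ, IsCriticalSet f C → t ∈ C}

/-- `f` is tame: there is a finite critical set and every `π₀(X_t)` is finite. -/
def IsTame (f : X → ℝ) : Prop :=
  (∃ C : Finset ℝ, IsCriticalSet f C) ∧ ∀ t, (comps f t).Finite

/-- `f` is regular: all topological changes happen at (and not across) the critical values. -/
def IsRegular (f : X → ℝ) : Prop :=
  ∀ t ∈ criticalValues f, ∃ C > 0, ∀ ε, 0 < ε → ε < C → InclBijective f t (t + ε)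

/-- The standing assumptions under which `f` has a merge tree. -/
structure HasMergeTree (f : X → ℝ) : Prop where
  pathConnected : PathConnectedSpace X
  tame : IsTame f
  regular : IsRegular f
  bddAbove : BddAbove (range f)
  bddBelow : BddBelow (range f)

/-- `s` is the critical value that immediately precedes `t`. -/
def IsPrevCritical (f : X → ℝ) (s t : ℝ) : Prop :=
  s ∈ criticalValues f ∧ s < t ∧ ∀ r ∈ criticalValues f, r < t → r ≤ s

/-- The component `p.2` of `X_{p.1}` carries a vertex of the merge tree, at height `p.1`: the
height is a critical value and either the component is new (a leaf), or at least two components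
of the sublevel set at the preceding critical value have merged into it. -/
def IsVertex (f : X → ℝ) (p : ℝ × Set X) : Prop :=
  p.1 ∈ criticalValues f ∧ p.2 ∈ comps f p.1 ∧
    ((∀ s, IsPrevCritical f s p.1 → ∀ V ∈ comps f s, ¬ V ⊆ p.2) ∨
      (∃ s, IsPrevCritical f s p.1 ∧
        ∃ V ∈ comps f s, ∃ W ∈ comps f s, V ≠ W ∧ V ⊆ p.2 ∧ W ⊆ p.2))

/-- The vertices of the merge tree of `f`, without the root. -/
abbrev Node (f : X → ℝ) : Type := {p : ℝ × Set X // IsVertex f p}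

/-- `q` lies strictly above `p`: its height is larger, and the component of `p` is contained in
the component of `q`. -/
def Above (f : X → ℝ) (p q : Node f) : Prop := p.1.1 < q.1.1 ∧ p.1.2 ⊆ q.1.2

open Classical in
/-- The father of a vertex: the lowest vertex strictly above it, and the root (`none`) when there
is no such vertex. -/
noncomputable def father (f : X → ℝ) : Option (Node f) → Option (Node f)
  | none => none
  | some p =>
    if h : ∃ q, Above f p q ∧ ∀ r, Above f p r → q.1.1 ≤ r.1.1 then some h.choose else none

/-- The height of a vertex, with `+∞` at the root. -/
noncomputable def nodeHeight (f : X → ℝ) : Option (Node f) → WithTop ℝ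
  | none => ⊤
  | some p => (p.1.1 : ℝ)

end Sublevel

/-! ### Rooted trees, merge trees and weighted trees -/

/-- A finite rooted tree, given by its vertices and by the father of each vertex. The edges are
the pairs `(v, parent v)` with `v ≠ root`. -/
structure RootedTree where
  V : Type
  finite : Finite V
  root : V
  parent : V → V
  parent_root : parent root = root
  reaches_root : ∀ v, ∃ n : ℕ, parent^[n] v = root

/-- A merge tree: a finite rooted tree whose root has order one, with a strictly monotone height
function that is `+∞` at the root and real elsewhere. -/
structure MergeTree extends RootedTree where
  root_order_one : ∃! v, v ≠ root ∧ parent v = root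
  height : V → WithTop ℝ
  height_root : height root = ⊤
  height_ne_top : ∀ v, v ≠ root → height v ≠ ⊤
  height_lt : ∀ v, v ≠ root → height v < height (parent v)

/-- A finite rooted tree with positive weights on its edges; `weight v` is the weight of the edge
`(v, parent v)`. The value of `weight` at the root is irrelevant. -/
structure WeightedTree extends RootedTree where
  weight : V → ℝ
  weight_pos : ∀ v, v ≠ root → 0 < weight v

/-- `K` is larger than all the finite heights of `T`. -/
def MergeTree.IsBelow (T : MergeTree) (K : ℝ) : Prop :=
  ∀ v, v ≠ T.root → T.height v < (K : WithTop ℝ)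

open Classical in
/-- The height function with the value at the root replaced by `K`. -/
noncomputable def MergeTree.truncHeight (T : MergeTree) (K : ℝ) (v : T.V) : ℝ :=
  if v = T.root then K else (T.height v).untopD 0

lemma MergeTree.truncHeight_lt (T : MergeTree) (K : ℝ) (hK : T.IsBelow K) (v : T.V)
    (hv : v ≠ T.root) : T.truncHeight K v < T.truncHeight K (T.parent v) := by
  obtain ⟨a, ha⟩ := WithTop.ne_top_iff_exists.1 (T.height_ne_top v hv)
  have h1 : T.truncHeight K v = a := by simp [truncHeight, hv, ← ha]
  rw [h1]
  by_cases hp : T.parent v = T.root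
  · have := hK v hv
    rw [← ha] at this
    simpa [truncHeight, hp] using this
  · obtain ⟨b, hb⟩ := WithTop.ne_top_iff_exists.1 (T.height_ne_top _ hp)
    have := T.height_lt v hv
    rw [← ha, ← hb] at this
    simpa [truncHeight, hp, ← hb] using this

/-- The weighted tree of a merge tree truncated at height `K`: the weight of an edge is the
difference of the (truncated) heights of its endpoints. -/
noncomputable def MergeTree.truncate (T : MergeTree) (K : ℝ) (hK : T.IsBelow K) :
    WeightedTree where
  toRootedTree := T.toRootedTree
  weight v := T.truncHeight K (T.parent v) - T.truncHeight K v
  weight_pos v hv := sub_pos.2 (T.truncHeight_lt K hK v hv)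

/-! ### Edits and the edit distance

Trees are considered up to isomorphism, so each edit is described as a relation between a tree
and the result of the edit. -/

/-- `e` is an isomorphism of rooted trees. -/
def IsTreeIso (T T' : RootedTree) (e : T.V ≃ T'.V) : Prop :=
  e T.root = T'.root ∧ ∀ u, e (T.parent u) = T'.parent (e u)

open Classical in
/-- `ι` identifies the vertices of `T'` with the vertices of `T` other than `v`, and the fathers
in `T'` are those of `T`, except that the father of `v` becomes the father of the children
of `v`. -/
def IsVertexRemoval (T T' : RootedTree) (v : T.V) (ι : T'.V → T.V) : Prop :=
  v ≠ T.root ∧ Function.Injective ι ∧ range ι = {v}ᶜ ∧ ι T'.root = T.root ∧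
    ∀ u, ι (T'.parent u) = if T.parent (ι u) = v then T.parent v else T.parent (ι u)

/-- `T'` is obtained from `T` by deleting the vertex `v` with the edge `(v, parent v)`. All other
edges keep their weight. -/
def IsDeletion (T T' : WeightedTree) (v : T.V) : Prop :=
  ∃ ι : T'.V → T.V, IsVertexRemoval T.toRootedTree T'.toRootedTree v ι ∧
    ∀ u, u ≠ T'.root → T'.weight u = T.weight (ι u)

open Classical in
/-- `T'` is obtained from `T` by ghosting the order two vertex `v`: `v` has exactly one child
`c`, and the edges `(c, v)` and `(v, parent v)` are joined to one edge, whose weight is the sum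
of their weights. -/
def IsGhosting (T T' : WeightedTree) (v : T.V) : Prop :=
  ∃ c, (∀ u, T.parent u = v ↔ u = c) ∧
    ∃ ι : T'.V → T.V, IsVertexRemoval T.toRootedTree T'.toRootedTree v ι ∧
      ∀ u, u ≠ T'.root →
        T'.weight u = if ι u = c then T.weight c + T.weight v else T.weight (ι u)

/-- `EditStep T T' c`: one edit, of cost `c`, leads from `T` to `T'`. Isomorphic trees are
identified. -/
inductive EditStep : WeightedTree → WeightedTree → ℝ → Prop
  | iso (T T' : WeightedTree) (e : T.V ≃ T'.V) :
      IsTreeIso T.toRootedTree T'.toRootedTree e →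
      (∀ u, u ≠ T.root → T'.weight (e u) = T.weight u) → EditStep T T' 0
  | shrink (T T' : WeightedTree) (e : T.V ≃ T'.V) (v : T.V) : v ≠ T.root →
      IsTreeIso T.toRootedTree T'.toRootedTree e →
      (∀ u, u ≠ T.root → u ≠ v → T'.weight (e u) = T.weight u) →
      EditStep T T' |T'.weight (e v) - T.weight v|
  | delete (T T' : WeightedTree) (v : T.V) : IsDeletion T T' v → EditStep T T' (T.weight v)
  | insert (T T' : WeightedTree) (v : T'.V) : IsDeletion T' T v → EditStep T T' (T'.weight v)
  | ghost (T T' : WeightedTree) (v : T.V) : IsGhosting T T' v → EditStep T T' 0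
  | split (T T' : WeightedTree) (v : T'.V) : IsGhosting T' T v → EditStep T T' 0

/-- `EditPath T T' c`: a finite composition of edits of total cost `c` leads from `T` to `T'`. -/
inductive EditPath : WeightedTree → WeightedTree → ℝ → Prop
  | nil (T : WeightedTree) : EditPath T T 0
  | cons (T T' T'' : WeightedTree) (c c' : ℝ) :
      EditStep T T' c → EditPath T' T'' c' → EditPath T T'' (c + c')

/-- The edit distance: the infimum of the costs of the edit paths from `T` to `T'`. -/
noncomputable def editDist (T T' : WeightedTree) : ENNReal :=
  ⨅ (c : ℝ) (_ : EditPath T T' c), ENNReal.ofReal c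

/-! ### The merge tree of a function -/

section Construction

variable {X : Type} [TopologicalSpace X] {f : X → ℝ}

lemma sublevel_mono {X : Type} {f : X → ℝ} {t t' : ℝ} (h : t ≤ t') :
    sublevel f t ⊆ sublevel f t' :=
  fun _ hx => le_trans hx h

lemma comps_nonempty {t : ℝ} {U : Set X} (hU : U ∈ comps f t) : U.Nonempty := by
  obtain ⟨x, hx, rfl⟩ := hU
  exact ⟨x, mem_pathComponentIn_self hx⟩

lemma comps_eq_of_mem {t : ℝ} {U V : Set X} (hU : U ∈ comps f t) (hV : V ∈ comps f t)
    {x : X} (hxU : x ∈ U) (hxV : x ∈ V) : U = V := by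
  obtain ⟨y, hy, rfl⟩ := hU
  obtain ⟨z, hz, rfl⟩ := hV
  rw [← pathComponentIn_congr hxU, ← pathComponentIn_congr hxV]

lemma exists_comps_superset {t t' : ℝ} (h : t ≤ t') {U : Set X} (hU : U ∈ comps f t) :
    ∃ V ∈ comps f t', U ⊆ V := by
  obtain ⟨x, hx, rfl⟩ := hU
  exact ⟨_, ⟨x, sublevel_mono h hx, rfl⟩, pathComponentIn_mono (sublevel_mono h)⟩

lemma InclBijective.trans {r s t : ℝ} (hrs : r ≤ s) (hst : s ≤ t) (h1 : InclBijective f r s)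
    (h2 : InclBijective f s t) : InclBijective f r t := by
  intro W hW
  obtain ⟨V, ⟨hV, hVW⟩, hVu⟩ := h2 W hW
  obtain ⟨U, ⟨hU, hUV⟩, hUu⟩ := h1 V hV
  refine ⟨U, ⟨hU, hUV.trans hVW⟩, ?_⟩
  rintro U' ⟨hU', hU'W⟩
  obtain ⟨V', hV', hUV'⟩ := exists_comps_superset hrs hU'
  obtain ⟨W', hW', hVW'⟩ := exists_comps_superset hst hV'
  obtain ⟨x, hx⟩ := comps_nonempty hU'
  have : W' = W := comps_eq_of_mem hW' hW (hVW' (hUV' hx)) (hU'W hx)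
  subst this
  have : V' = V := hVu V' ⟨hV', hVW'⟩
  subst this
  exact hUu U' ⟨hU', hUV'⟩

lemma IsCriticalSet.erase {C D : Finset ℝ} (hC : IsCriticalSet f C) (hD : IsCriticalSet f D)
    {c : ℝ} (hcD : c ∉ D) : IsCriticalSet f (C.erase c) := by
  intro t t' htt' hav
  by_cases hc : c ∈ Icc t t'
  · obtain ⟨δ, hδ, hδD⟩ : ∃ δ > 0, ∀ d ∈ D, d ∉ Icc (c - δ) (c + δ) := by
      have hop : (D : Set ℝ)ᶜ ∈ nhds c :=
        D.finite_toSet.isClosed.isOpen_compl.mem_nhds (by simpa using hcD)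
      obtain ⟨δ, hδ, hsub⟩ := Metric.nhds_basis_closedBall.mem_iff.1 hop
      refine ⟨δ, hδ, fun d hd hd' => ?_⟩
      rw [← Real.closedBall_eq_Icc] at hd'
      exact hsub hd' hd
    have hne : ∀ e ∈ C, e ∈ Icc t t' → e = c := by
      intro e he he'
      by_contra hec
      exact hav e (Finset.mem_erase.2 ⟨hec, he⟩) he'
    have key : InclBijective f (max t (c - δ)) (min t' (c + δ)) := by
      refine hD _ _ ?_ ?_
      · refine max_le (le_min htt' (hc.1.trans (by linarith))) (le_min ?_ (by linarith))
        linarith [hc.2]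
      · intro d hd hd'
        exact hδD d hd ⟨(le_max_right _ _).trans hd'.1, hd'.2.trans (min_le_right _ _)⟩
    have left : InclBijective f t (max t (c - δ)) := by
      rcases le_total (c - δ) t with h | h
      · rw [max_eq_left h]
        intro V hV
        refine ⟨V, ⟨hV, Subset.rfl⟩, ?_⟩
        rintro U ⟨hU, hUV⟩
        obtain ⟨x, hx⟩ := comps_nonempty hU
        exact comps_eq_of_mem hU hV hx (hUV hx)
      · rw [max_eq_right h]
        refine hC _ _ h ?_
        intro e he he'
        have := hne e he ⟨he'.1, by linarith [he'.2, hc.2]⟩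
        linarith [he'.2]
    have right : InclBijective f (min t' (c + δ)) t' := by
      rcases le_total t' (c + δ) with h | h
      · rw [min_eq_left h]
        intro V hV
        refine ⟨V, ⟨hV, Subset.rfl⟩, ?_⟩
        rintro U ⟨hU, hUV⟩
        obtain ⟨x, hx⟩ := comps_nonempty hU
        exact comps_eq_of_mem hU hV hx (hUV hx)
      · rw [min_eq_right h]
        refine hC _ _ h ?_
        intro e he he'
        have := hne e he ⟨by linarith [he'.1, hc.1], he'.2⟩
        linarith [he'.1]
    have h1 : max t (c - δ) ≤ min t' (c + δ) :=
      max_le (le_min htt' (hc.1.trans (by linarith)))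
        (le_min (by linarith [hc.2]) (by linarith))
    exact (left.trans (le_max_left _ _) h1 key).trans
      ((le_max_left _ _).trans h1) (min_le_left _ _) right
  · refine hC _ _ htt' ?_
    intro e he he'
    by_cases hec : e = c
    · exact hc (hec ▸ he')
    · exact hav e (Finset.mem_erase.2 ⟨hec, he⟩) he'

/-- The critical values of a tame function form a critical set. -/
lemma IsTame.exists_criticalValues (h : IsTame f) :
    ∃ C : Finset ℝ, IsCriticalSet f C ∧ (C : Set ℝ) = criticalValues f := by
  classical
  have hex : ∃ n, ∃ C : Finset ℝ, IsCriticalSet f C ∧ C.card = n := by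
    obtain ⟨C, hC⟩ := h.1
    exact ⟨_, C, hC, rfl⟩
  obtain ⟨C, hC, hn⟩ := Nat.find_spec hex
  refine ⟨C, hC, Subset.antisymm ?_ fun t ht => ht C hC⟩
  intro c hc D hD
  by_contra hcD
  have hlt : (C.erase c).card < Nat.find hex := hn ▸ Finset.card_erase_lt_of_mem hc
  exact Nat.find_min hex hlt ⟨_, hC.erase hD hcD, rfl⟩

lemma IsTame.finite_node (h : IsTame f) : Finite (Node f) := by
  obtain ⟨C, -, hCe⟩ := h.exists_criticalValues
  have hfin : (⋃ t ∈ (C : Set ℝ), ({t} : Set ℝ) ×ˢ comps f t).Finite :=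
    C.finite_toSet.biUnion fun t _ => (finite_singleton t).prod (h.2 t)
  refine (hfin.subset ?_ : {p | IsVertex f p}.Finite).to_subtype
  intro p hp
  simp only [mem_iUnion]
  exact ⟨p.1, by rw [hCe]; exact hp.1, rfl, hp.2.1⟩

lemma father_spec (hfin : Finite (Node f)) (p : Node f) :
    (father f (some p) = none ∧ ∀ q, ¬ Above f p q) ∨
      ∃ q, father f (some p) = some q ∧ Above f p q ∧ ∀ r, Above f p r → q.1.1 ≤ r.1.1 := by
  by_cases h : ∃ q, Above f p q ∧ ∀ r, Above f p r → q.1.1 ≤ r.1.1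
  · right
    exact ⟨h.choose, by simp only [father]; rw [dif_pos h], h.choose_spec⟩
  · left
    refine ⟨by simp only [father]; rw [dif_neg h], fun q hq => h ?_⟩
    obtain ⟨r, hr, hmin⟩ := (toFinite {q | Above f p q}).exists_minimalFor (fun q => q.1.1)
      {q | Above f p q} ⟨q, hq⟩
    refine ⟨r, hr, fun s hs => ?_⟩
    rcases le_total r.1.1 s.1.1 with h' | h'
    · exact h'
    · exact hmin hs h'

lemma father_reaches (hfin : Finite (Node f)) (v : Option (Node f)) :
    ∃ n : ℕ, (father f)^[n] v = none := by
  rcases v with _ | p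
  · exact ⟨0, rfl⟩
  · have wf : WellFounded fun p q : Node f => q.1.1 < p.1.1 :=
      haveI : IsTrans (Node f) fun p q : Node f => q.1.1 < p.1.1 :=
        ⟨fun a b c h1 h2 => lt_trans h2 h1⟩
      haveI : Std.Irrefl fun p q : Node f => q.1.1 < p.1.1 := ⟨fun a => lt_irrefl _⟩
      Finite.wellFounded_of_trans_of_irrefl _
    induction p using wf.induction with
    | _ p ih =>
      rcases father_spec hfin p with ⟨h, -⟩ | ⟨q, h, hq, -⟩
      · exact ⟨1, h⟩
      · obtain ⟨n, hn⟩ := ih q hq.1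
        exact ⟨n + 1, by rw [Function.iterate_succ_apply, h, hn]⟩

lemma comps_top [PathConnectedSpace X] {T : ℝ} (hT : ∀ x, f x ≤ T) : comps f T = {univ} := by
  have hs : sublevel f T = univ := eq_univ_of_forall hT
  have hu : ∀ x : X, pathComponentIn (univ : Set X) x = univ := fun x => by
    rw [pathComponentIn_univ]
    exact eq_univ_of_forall fun y => PathConnectedSpace.joined x y
  ext U
  simp only [comps, hs, hu, mem_univ, true_and, mem_ofPred_eq, mem_singleton_iff]
  exact ⟨fun ⟨_, h⟩ => h, fun h => ⟨Classical.arbitrary X, h⟩⟩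

/-- Exactly one vertex of the merge tree has no vertex above it. -/
lemma HasMergeTree.existsUnique_top (h : HasMergeTree f) :
    ∃! p : Node f, ∀ q, ¬ Above f p q := by
  classical
  haveI := h.pathConnected
  obtain ⟨C, hC, hCe⟩ := h.tame.exists_criticalValues
  have hCm : ∀ {t}, t ∈ C ↔ t ∈ criticalValues f := fun {t} => by rw [← hCe, Finset.mem_coe]
  obtain ⟨M, hM⟩ := h.bddAbove
  obtain ⟨m, hm⟩ := h.bddBelow
  have hM' : ∀ x, f x ≤ M := fun x => hM ⟨x, rfl⟩
  have hm' : ∀ x, m ≤ f x := fun x => hm ⟨x, rfl⟩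
  have hempty : ∀ t, t < m → comps f t = ∅ := by
    intro t ht
    refine eq_empty_of_forall_notMem ?_
    rintro U ⟨x, hx, -⟩
    exact absurd (hm' x) (not_le.2 (lt_of_le_of_lt hx ht))
  -- from a critical value to the levels just above it
  have hgap : ∀ s ∈ C, ∀ t, s < t → (∀ c ∈ C, c ∉ Ioc s t) → InclBijective f s t := by
    intro s hs t hst hav
    obtain ⟨D, hD, hDε⟩ := h.regular s (hCm.1 hs)
    have hpos : 0 < min D (t - s) := lt_min hD (by linarith)
    have hle : s + min D (t - s) / 2 ≤ t := by
      linarith [min_le_right D (t - s)]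
    refine (hDε (min D (t - s) / 2) (by linarith)
      (by linarith [min_le_left D (t - s)])).trans (by linarith) hle (hC _ _ hle ?_)
    intro c hc hc'
    exact hav c hc ⟨by linarith [hc'.1], hc'.2⟩
  -- there are critical values
  have hCne : C.Nonempty := by
    rw [Finset.nonempty_iff_ne_empty]
    rintro rfl
    have hb := hC (m - 1) (max M m) (by linarith [le_max_right M m]) (by simp)
    obtain ⟨U, ⟨hU, -⟩, -⟩ := hb univ
      (by rw [comps_top fun x => (hM' x).trans (le_max_left _ _)]; rfl)
    rw [hempty _ (by linarith)] at hU
    exact hU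
  set T := C.max' hCne with hTdef
  have hTC : T ∈ C := C.max'_mem hCne
  have hTmax : ∀ c ∈ C, c ≤ T := fun c hc => C.le_max' c hc
  -- above the last critical value there is one component
  have htop : ∀ t, T ≤ t → ∃ U, comps f t = {U} := by
    intro t ht
    set B := max M (t + 1)
    have hB : comps f B = {univ} := comps_top fun x => (hM' x).trans (le_max_left _ _)
    have htB : t < B := lt_of_lt_of_le (by linarith) (le_max_right M (t + 1))
    have hbij : InclBijective f t B := by
      rcases ht.eq_or_lt with rfl | ht
      · exact hgap T hTC B htB fun c hc hc' => absurd hc'.1 (not_lt.2 (hTmax c hc))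
      · exact hC _ _ htB.le fun c hc hc' => absurd (hTmax c hc) (not_le.2 (ht.trans_le hc'.1))
    obtain ⟨U, ⟨hU, -⟩, hu⟩ := hbij univ (by rw [hB]; rfl)
    exact ⟨U, Subset.antisymm (fun V hV => hu V ⟨hV, subset_univ _⟩) (by simpa using hU)⟩
  obtain ⟨U₀, hU₀⟩ := htop T le_rfl
  have hsub : ∀ s, s ≤ T → ∀ V ∈ comps f s, V ⊆ U₀ := by
    intro s hs V hV
    obtain ⟨W, hW, hVW⟩ := exists_comps_superset hs hV
    rw [hU₀] at hW
    exact (show W = U₀ from hW) ▸ hVW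
  have hle : ∀ p : Node f, p.1.1 ≤ T := fun p => hTmax _ (hCm.2 p.2.1)
  -- a vertex without vertices above it is the component at the last critical value
  have huniq : ∀ p : Node f, (∀ q, ¬ Above f p q) → p.1 = (T, U₀) := by
    intro p hp
    rcases (hle p).eq_or_lt with heq | hlt
    · refine Prod.ext heq ?_
      have := p.2.2.1
      rw [heq, hU₀] at this
      exact this
    exfalso
    obtain ⟨s, hs, hsmax⟩ : ∃ s ∈ C.filter (· < T), ∀ r ∈ C.filter (· < T), r ≤ s := by
      have hne : (C.filter (· < T)).Nonempty :=
        ⟨p.1.1, Finset.mem_filter.2 ⟨hCm.2 p.2.1, hlt⟩⟩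
      exact ⟨_, Finset.max'_mem _ hne, fun r hr => Finset.le_max' _ r hr⟩
    rw [Finset.mem_filter] at hs
    have hps : p.1.1 ≤ s := hsmax _ (Finset.mem_filter.2 ⟨hCm.2 p.2.1, hlt⟩)
    have hprev : IsPrevCritical f s T :=
      ⟨hCm.1 hs.1, hs.2, fun r hr hrT => hsmax r (Finset.mem_filter.2 ⟨hCm.2 hr, hrT⟩)⟩
    obtain ⟨V, hV, -⟩ := exists_comps_superset hps p.2.2.1
    by_cases hall : ∀ W ∈ comps f s, W = V
    · -- then the last critical value could be removed
      have hsing : ∀ t, s < t → ∃ U, comps f t = {U} := by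
        intro t hst
        rcases le_or_gt T t with hTt | htT
        · exact htop t hTt
        have hb : InclBijective f s t := hgap s hs.1 t hst fun c hc hc' =>
          absurd (hsmax c (Finset.mem_filter.2 ⟨hc, hc'.2.trans_lt htT⟩)) (not_le.2 hc'.1)
        obtain ⟨W, hW, hVW⟩ := exists_comps_superset hst.le hV
        refine ⟨W, Subset.antisymm ?_ (by simpa using hW)⟩
        intro W' hW'
        obtain ⟨V', ⟨hV', hVW'⟩, -⟩ := hb W' hW'
        rw [hall V' hV'] at hVW'
        obtain ⟨x, hx⟩ := comps_nonempty hV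
        exact comps_eq_of_mem hW' hW (hVW' hx) (hVW hx)
      have hcrit : IsCriticalSet f (C.erase T) := by
        intro t t' htt' hav
        by_cases hT : T ∈ Icc t t'
        · have hst : s < t := by
            by_contra hts
            exact hav s (Finset.mem_erase.2 ⟨hs.2.ne, hs.1⟩)
              ⟨not_lt.1 hts, hs.2.le.trans hT.2⟩
          obtain ⟨A, hA⟩ := hsing t hst
          obtain ⟨B, hB⟩ := hsing t' (hst.trans_le htt')
          intro W hW
          obtain ⟨W', hW', hAW'⟩ := exists_comps_superset (f := f) htt'
            (show A ∈ comps f t by rw [hA]; rfl)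
          rw [hB] at hW hW'
          have hAW : A ⊆ W := by
            rw [show W = B from hW, ← show W' = B from hW']
            exact hAW'
          refine ⟨A, ⟨by rw [hA]; rfl, hAW⟩, fun U hU => ?_⟩
          have := hU.1
          rw [hA] at this
          exact this
        · refine hC t t' htt' fun c hc hc' => ?_
          by_cases hcT : c = T
          · exact hT (hcT ▸ hc')
          · exact hav c (Finset.mem_erase.2 ⟨hcT, hc⟩) hc'
      exact absurd (hCm.1 hTC _ hcrit) (Finset.notMem_erase T C)
    · push Not at hall
      obtain ⟨W, hW, hWV⟩ := hall
      exact hp ⟨(T, U₀), hCm.1 hTC, by simp [hU₀], Or.inr ⟨s, hprev, W, hW, V, hV, hWV,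
        hsub s hs.2.le W hW, hsub s hs.2.le V hV⟩⟩ ⟨hlt, hsub _ hlt.le _ p.2.2.1⟩
  -- existence
  have hnode : Nonempty (Node f) := by
    have hne : (C.filter fun t => (comps f t).Nonempty).Nonempty :=
      ⟨T, Finset.mem_filter.2 ⟨hTC, U₀, by rw [hU₀]; rfl⟩⟩
    have hs := Finset.mem_filter.1 (Finset.min'_mem _ hne)
    set s := Finset.min' _ hne
    obtain ⟨U, hU⟩ := hs.2
    refine ⟨⟨(s, U), hCm.1 hs.1, hU, Or.inl fun r hr V hV _ => ?_⟩⟩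
    exact absurd hr.2.1 (not_lt.2 (Finset.min'_le _ r
      (Finset.mem_filter.2 ⟨hCm.2 hr.1, V, hV⟩)))
  haveI := h.tame.finite_node
  obtain ⟨p, hp⟩ := Finite.exists_max fun p : Node f => p.1.1
  refine ⟨p, fun q hq => absurd hq.1 (not_lt.2 (hp q)), fun q hq => ?_⟩
  exact Subtype.ext ((huniq q hq).trans
    (huniq p fun r hr => absurd hr.1 (not_lt.2 (hp r))).symm)

/-- The merge tree `T_f`. -/
noncomputable def mergeTree (f : X → ℝ) (h : HasMergeTree f) : MergeTree where
  V := Option (Node f)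
  finite := haveI := h.tame.finite_node; inferInstance
  root := none
  parent := father f
  parent_root := rfl
  reaches_root := father_reaches h.tame.finite_node
  root_order_one := by
    obtain ⟨p, hp, hu⟩ := h.existsUnique_top
    refine ⟨some p, ⟨by simp, ?_⟩, ?_⟩
    · rcases father_spec h.tame.finite_node p with ⟨h1, -⟩ | ⟨q, -, hq, -⟩
      · exact h1
      · exact absurd hq (hp q)
    · rintro (_ | q) ⟨hq, hq'⟩
      · exact absurd rfl hq
      · rcases father_spec h.tame.finite_node q with ⟨-, h1⟩ | ⟨r, hr, -⟩
        · rw [hu q h1]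
        · rw [hr] at hq'
          exact absurd hq' (by simp)
  height := nodeHeight f
  height_root := rfl
  height_ne_top := by
    rintro (_ | p) hp
    · exact absurd rfl hp
    · exact WithTop.coe_ne_top
  height_lt := by
    rintro (_ | p) hp
    · exact absurd rfl hp
    · rcases father_spec h.tame.finite_node p with ⟨h1, -⟩ | ⟨q, h1, hq, -⟩
      · rw [h1]
        exact WithTop.coe_lt_top _
      · rw [h1]
        exact WithTop.coe_lt_coe.2 hq.1

end Construction

/-! ### Piecewise polynomial functions -/

/-- `f` is piecewise polynomial of degree at most `d` on the grid of knots
`x 0 < x 1 < ⋯ < x n`: on each open interval between consecutive knots it agrees with a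
polynomial of degree at most `d`. The values at the knots are not constrained; splines are the
continuous functions (possibly with further smoothness) of this kind. -/
def IsPiecewisePolynomial {n : ℕ} (x : Fin (n + 1) → ℝ) (d : ℕ)
    (f : Icc (x 0) (x (Fin.last n)) → ℝ) : Prop :=
  ∀ i : Fin n, ∃ p : Polynomial ℝ, p.natDegree ≤ d ∧
    ∀ y : Icc (x 0) (x (Fin.last n)), (y : ℝ) ∈ Ioo (x i.castSucc) (x i.succ) → f y = p.eval (y : ℝ)

end MergeTrees

/-!
The merge tree is compared with *level trees*: for a finite set `Λ` of levels, the level tree of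
`f` has the components of the sublevel sets `{f ≤ s}`, `s ∈ Λ`, as vertices, ordered by inclusion,
and a root of height `K`. Three facts carry the proof.

* If `Λ` contains all critical values of `f`, the merge tree arises from the level tree by ghosting,
  hence at cost zero: a component that carries no vertex contains exactly one component of the level
  below (`editLE_mergeTree_pieces`).
* If each level of `Λ` has a level of `S ⊆ Λ` at most `η` above it, then the level tree for `Λ`
  turns into that for `S` at a cost linear in `η`: a vertex is deleted after its edge has been added
  to the edges of its children (`editLE_pieces_subset`).
* If `|f - g| ≤ δ` and neither function has critical values in `(b, b + 2δ]` for `b ∈ S`, then the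
  level trees of `f` and `g` for `S` are isomorphic. This is the usual interleaving argument: the
  inclusions `{f ≤ b} ⊆ {g ≤ b + δ} ⊆ {f ≤ b + 2δ}`, and those with `f` and `g` exchanged, induce
  bijections of the components (`editLE_tree_pieces`).

Let `Λ` consist of the critical values of both functions and `S` of those that are followed by a gap
of length `2δ`. Then each level of `Λ` is within `2δ |Λ|` below one of `S`, so that the edit
distance is at most a multiple of `δ` depending only on the number of critical values and of
components (`HasMergeTree.editLE_truncate`). All levels of `Λ` are below the truncation height `K`,
because every critical value is the height of a vertex (`HasMergeTree.exists_node`).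

For piecewise polynomial functions these numbers are bounded in terms of the grid and the degree,
since the knots and the zeros of the derivatives cut the interval into intervals of monotonicity
(`IsPiecewisePolynomial.exists_bound`). In an interval two points lie in one path component of a set
exactly if the set contains the interval between them, and so the components can only change at the
values at the cut points and at the infima and suprema in between. If `f` is continuous, descending
inside an interval of monotonicity leads to a cut point, which gives regularity; otherwise
regularity is a hypothesis.
-/

namespace MergeTrees

/-! ### Composing edits -/

lemma EditPath.trans {T T' T'' : WeightedTree} {c c' : ℝ} (h : EditPath T T' c)
    (h' : EditPath T' T'' c') : EditPath T T'' (c + c') := by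
  induction h with
  | nil => simpa using h'
  | cons T T₁ T₂ a b hs _ ih => rw [add_assoc]; exact .cons _ _ _ _ _ hs (ih h')

lemma EditStep.editPath {T T' : WeightedTree} {c : ℝ} (h : EditStep T T' c) : EditPath T T' c := by
  simpa using EditPath.cons _ _ _ _ _ h (.nil T')

lemma IsTreeIso.symm {T T' : RootedTree} {e : T.V ≃ T'.V} (h : IsTreeIso T T' e) :
    IsTreeIso T' T e.symm :=
  ⟨by rw [← h.1, e.symm_apply_apply], fun u => by
    rw [Equiv.symm_apply_eq, h.2, e.apply_symm_apply]⟩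

lemma IsTreeIso.symm_apply_ne {T T' : RootedTree} {e : T.V ≃ T'.V} (h : IsTreeIso T T' e)
    {u : T'.V} (hu : u ≠ T'.root) : e.symm u ≠ T.root := by
  rwa [Ne, Equiv.symm_apply_eq, h.1]

lemma EditStep.symm {T T' : WeightedTree} {c : ℝ} (h : EditStep T T' c) : EditStep T' T c := by
  cases h with
  | iso e he hw =>
    refine .iso _ _ e.symm he.symm fun u hu => ?_
    rw [← hw _ (he.symm_apply_ne hu), e.apply_symm_apply]
  | shrink e v hv he hw =>
    have := EditStep.shrink T' T e.symm (e v) (fun h' => hv (e.injective (h'.trans he.1.symm)))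
      he.symm fun u hu huv => by
        rw [← hw _ (he.symm_apply_ne hu) fun h' => huv (by rw [← h', e.apply_symm_apply]),
          e.apply_symm_apply]
    rwa [e.symm_apply_apply, abs_sub_comm] at this
  | delete v h => exact .insert _ _ _ h
  | insert v h => exact .delete _ _ _ h
  | ghost v h => exact .split _ _ _ h
  | split v h => exact .ghost _ _ _ h

lemma EditPath.symm {T T' : WeightedTree} {c : ℝ} (h : EditPath T T' c) : EditPath T' T c := by
  induction h with
  | nil => exact .nil _
  | cons T T₁ T₂ a b hs _ ih => rw [add_comm]; exact ih.trans hs.symm.editPath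

/-- Some edit path of total cost at most `c` leads from `T` to `T'`. -/
def EditLE (T T' : WeightedTree) (c : ℝ) : Prop := ∃ c' ≤ c, EditPath T T' c'

lemma EditLE.refl (T : WeightedTree) : EditLE T T 0 := ⟨0, le_rfl, .nil T⟩

lemma EditLE.trans {T T' T'' : WeightedTree} {c c' : ℝ} (h : EditLE T T' c)
    (h' : EditLE T' T'' c') : EditLE T T'' (c + c') := by
  obtain ⟨a, ha, h⟩ := h
  obtain ⟨b, hb, h'⟩ := h'
  exact ⟨a + b, add_le_add ha hb, h.trans h'⟩

lemma EditLE.symm {T T' : WeightedTree} {c : ℝ} (h : EditLE T T' c) : EditLE T' T c := by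
  obtain ⟨a, ha, h⟩ := h
  exact ⟨a, ha, h.symm⟩

lemma EditLE.mono {T T' : WeightedTree} {c c' : ℝ} (h : EditLE T T' c) (hc : c ≤ c') :
    EditLE T T' c' := by
  obtain ⟨a, ha, h⟩ := h
  exact ⟨a, ha.trans hc, h⟩

lemma EditStep.editLE {T T' : WeightedTree} {c : ℝ} (h : EditStep T T' c) : EditLE T T' c :=
  ⟨c, le_rfl, h.editPath⟩

lemma EditLE.editDist_le {T T' : WeightedTree} {c : ℝ} (h : EditLE T T' c) :
    editDist T T' ≤ ENNReal.ofReal c := by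
  obtain ⟨a, ha, h⟩ := h
  exact (iInf₂_le a h).trans (ENNReal.ofReal_le_ofReal ha)

/-- Changing the weights on a finite set `A` of edges by at most `η` each, one edge at a time. -/
lemma editLE_reweight (T : WeightedTree) (η : ℝ) (hη : 0 ≤ η) (A : Finset T.V) :
    ∀ (w : T.V → ℝ) (hw : ∀ v, v ≠ T.root → 0 < w v), (∀ v ∉ A, w v = T.weight v) →
      (∀ v, |w v - T.weight v| ≤ η) →
      EditLE T { T with weight := w, weight_pos := hw } (A.card * η) := by
  classical
  induction A using Finset.induction_on with
  | empty =>
    intro w hw hwA _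
    have : w = T.weight := funext fun v => hwA v (by simp)
    subst this
    simpa using EditLE.refl T
  | insert a A ha ih =>
    intro w hw hwA hwη
    set w₁ : T.V → ℝ := Function.update w a (T.weight a) with hw₁
    have hpos : ∀ v, v ≠ T.root → 0 < w₁ v := by
      intro v hv
      by_cases hva : v = a
      · subst hva; simpa [hw₁] using T.weight_pos v hv
      · simpa [hw₁, hva] using hw v hv
    have h1 := ih w₁ hpos
      (fun v hv => by
        by_cases hva : v = a
        · subst hva; simp [hw₁]
        · rw [hw₁, Function.update_of_ne hva]
          exact hwA v (by simp [hva, hv]))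
      (fun v => by
        by_cases hva : v = a
        · subst hva; simpa [hw₁] using hη
        · rw [hw₁, Function.update_of_ne hva]; exact hwη v)
    have h2 : EditLE { T with weight := w₁, weight_pos := hpos }
        { T with weight := w, weight_pos := hw } η := by
      by_cases har : a = T.root
      · refine (EditStep.iso { T with weight := w₁, weight_pos := hpos }
          { T with weight := w, weight_pos := hw } (Equiv.refl _)
          ⟨rfl, fun _ => rfl⟩ fun u hu => ?_).editLE.mono hη
        have : u ≠ a := fun h => hu (h.trans har)
        simp [hw₁, this]
      · refine (EditStep.shrink { T with weight := w₁, weight_pos := hpos }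
          { T with weight := w, weight_pos := hw } (Equiv.refl _) a har
          ⟨rfl, fun _ => rfl⟩ fun u hu hua => ?_).editLE.mono ?_
        · simp [hw₁, hua]
        · simpa [hw₁] using hwη a
    refine (h1.trans h2).mono ?_
    rw [Finset.card_insert_of_notMem ha]
    push_cast
    linarith

/-! ### Trees of finite subsets of a forest order -/

/-- A real-valued height on `α` together with a strict order `R` ("lies above"), along which the
height increases, such that the elements above a given one are linearly ordered by height. -/
structure HeightForest (α : Type) where
  h : α → ℝ
  R : α → α → Prop
  lt : ∀ {p q}, R p q → h p < h q
  trans : ∀ {p q r}, R p q → R q r → R p r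
  chain : ∀ {p q r}, R p q → R p r → h q ≤ h r → q = r ∨ R q r

namespace HeightForest

variable {α β : Type} (H : HeightForest α)

/-- `o` is the lowest element of `F` above `a`, with `none` standing for the root, which lies above
everything. -/
def IsLowestAbove (F : Finset α) (a : α) : Option α → Prop
  | none => ∀ q ∈ F, ¬ H.R a q
  | some b => b ∈ F ∧ H.R a b ∧ ∀ r ∈ F, H.R a r → H.h b ≤ H.h r

lemma IsLowestAbove.unique {H : HeightForest α} {F : Finset α} {a : α} {o o' : Option α}
    (ho : H.IsLowestAbove F a o) (ho' : H.IsLowestAbove F a o') : o = o' := by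
  rcases o with _ | b <;> rcases o' with _ | b'
  · rfl
  · exact absurd ho'.2.1 (ho b' ho'.1)
  · exact absurd ho.2.1 (ho' b ho.1)
  · have h1 := ho.2.2 b' ho'.1 ho'.2.1
    have h2 := ho'.2.2 b ho.1 ho.2.1
    rcases H.chain ho.2.1 ho'.2.1 h1 with h | h
    · rw [h]
    · exact absurd (H.lt h) (not_lt.2 h2)

lemma exists_isLowestAbove (F : Finset α) (a : α) :
    ∃ o : Option {p // p ∈ F}, H.IsLowestAbove F a (o.map (↑)) := by
  classical
  by_cases hne : (F.filter (H.R a)).Nonempty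
  · obtain ⟨b, hb, hmin⟩ := Finset.exists_min_image _ H.h hne
    rw [Finset.mem_filter] at hb
    exact ⟨some ⟨b, hb.1⟩, hb.1, hb.2, fun r hr har => hmin r (Finset.mem_filter.2 ⟨hr, har⟩)⟩
  · exact ⟨none, fun q hq haq => hne ⟨q, Finset.mem_filter.2 ⟨hq, haq⟩⟩⟩

/-- The father of a vertex in the tree of `F`. -/
noncomputable def father (F : Finset α) : Option {p // p ∈ F} → Option {p // p ∈ F}
  | none => none
  | some p => (H.exists_isLowestAbove F p).choose

lemma father_isLowestAbove (F : Finset α) (p : {p // p ∈ F}) :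
    H.IsLowestAbove F p ((H.father F (some p)).map (↑)) :=
  (H.exists_isLowestAbove F p).choose_spec

/-- The height, extended by `K` to the root. -/
def optHeight (K : ℝ) : Option α → ℝ
  | none => K
  | some a => H.h a

lemma lt_optHeight {F : Finset α} {K : ℝ} (hK : ∀ p ∈ F, H.h p < K) {a : α} (ha : a ∈ F)
    {o : Option α} (ho : H.IsLowestAbove F a o) : H.h a < H.optHeight K o := by
  rcases o with _ | b
  · exact hK a ha
  · exact H.lt ho.2.1

lemma father_reaches (F : Finset α) (v : Option {p // p ∈ F}) :
    ∃ n : ℕ, (H.father F)^[n] v = none := by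
  classical
  -- induction on the number of elements of `F` that are higher than the vertex
  suffices h : ∀ (m : ℕ) (p : {p // p ∈ F}), (F.filter fun q => H.h p < H.h q).card = m →
      ∃ n : ℕ, (H.father F)^[n] (some p) = none by
    rcases v with _ | p
    · exact ⟨0, rfl⟩
    · exact h _ p rfl
  intro m
  induction m using Nat.strong_induction_on with
  | _ m ih =>
    intro p hp
    have hs := H.father_isLowestAbove F p
    rcases hq : H.father F (some p) with _ | q
    · exact ⟨1, hq⟩
    · rw [hq] at hs
      have hlt := H.lt hs.2.1
      obtain ⟨n, hn⟩ := ih _ (by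
        rw [← hp]
        refine Finset.card_lt_card (Finset.ssubset_iff_subset_ne.2 ⟨fun r hr => ?_, fun he => ?_⟩)
        · rw [Finset.mem_filter] at hr ⊢
          exact ⟨hr.1, hlt.trans hr.2⟩
        · have : (q : α) ∈ F.filter fun r => H.h p < H.h r := Finset.mem_filter.2 ⟨q.2, hlt⟩
          rw [← he, Finset.mem_filter] at this
          exact lt_irrefl _ this.2) q rfl
      exact ⟨n + 1, by rw [Function.iterate_succ_apply, hq, hn]⟩

/-- The weighted tree whose vertices are the elements of `F` and a root of height `K`, the father
of a vertex being the lowest vertex above it. -/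
noncomputable abbrev tree (F : Finset α) (K : ℝ) (hK : ∀ p ∈ F, H.h p < K) : WeightedTree where
  V := Option {p // p ∈ F}
  finite := inferInstance
  root := none
  parent := H.father F
  parent_root := rfl
  reaches_root := H.father_reaches F
  weight v := H.optHeight K ((H.father F v).map (↑)) - H.optHeight K (v.map (↑))
  weight_pos := by
    rintro (_ | p) hp
    · exact absurd rfl hp
    · exact sub_pos.2 (H.lt_optHeight hK p.2 (H.father_isLowestAbove F p))

/-- The rooted tree `T` with edge weights is, via `e`, the tree of `F` with root of height `K`. -/
structure Realizes (F : Finset α) (K : ℝ) (T : WeightedTree) (e : T.V ≃ Option {p // p ∈ F}) :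
    Prop where
  root : e T.root = none
  parent : ∀ v p, e v = some p → H.IsLowestAbove F p ((e (T.parent v)).map (↑))
  weight : ∀ v, v ≠ T.root →
    T.weight v = H.optHeight K ((e (T.parent v)).map (↑)) - H.optHeight K ((e v).map (↑))

lemma tree_realizes (F : Finset α) (K : ℝ) (hK : ∀ p ∈ F, H.h p < K) :
    H.Realizes F K (H.tree F K hK) (Equiv.refl _) where
  root := rfl
  parent := by
    rintro v p h
    subst h
    exact H.father_isLowestAbove F p
  weight := fun _ _ => rfl

/-- A bijection preserving height and order identifies the trees. -/
lemma editLE_of_realizes {H : HeightForest α} {H' : HeightForest β} {F : Finset α} {F' : Finset β}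
    {K : ℝ} {T T' : WeightedTree} {e : T.V ≃ Option {p // p ∈ F}}
    {e' : T'.V ≃ Option {p // p ∈ F'}} (hT : H.Realizes F K T e) (hT' : H'.Realizes F' K T' e')
    (φ : {p // p ∈ F} ≃ {p // p ∈ F'}) (hh : ∀ a, H'.h (φ a) = H.h a)
    (hR : ∀ a b : {p // p ∈ F}, H.R a b ↔ H'.R (φ a) (φ b)) : EditLE T T' 0 := by
  have hpar : ∀ u, e' (T'.parent (e'.symm (Option.map φ (e u)))) =
      Option.map φ (e (T.parent u)) := by
    intro u
    rcases hu : e u with _ | a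
    · have h1 : u = T.root := e.injective (hu.trans hT.root.symm)
      have h2 : e'.symm none = T'.root := e'.symm_apply_eq.2 hT'.root.symm
      rw [h1, T.parent_root, hT.root, Option.map_none, h2, T'.parent_root, hT'.root]
    · have h1 := hT'.parent (e'.symm (some (φ a))) (φ a) (e'.apply_symm_apply _)
      have h2 := hT.parent u a hu
      have h3 : H'.IsLowestAbove F' (φ a) ((Option.map φ (e (T.parent u))).map (↑)) := by
        rcases hb : e (T.parent u) with _ | b <;> rw [hb] at h2
        · intro q hq haq
          obtain ⟨r, hr⟩ := φ.surjective ⟨q, hq⟩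
          refine h2 r r.2 ((hR a r).2 ?_)
          rw [hr]; exact haq
        · refine ⟨(φ b).2, (hR _ _).1 h2.2.1, fun q hq haq => ?_⟩
          obtain ⟨r, hr⟩ := φ.surjective ⟨q, hq⟩
          have h4 : H'.h (φ r) = H'.h q := by rw [hr]
          rw [← h4]
          show H'.h (φ b) ≤ H'.h (φ r)
          rw [hh, hh]
          refine h2.2.2 r r.2 ((hR a r).2 ?_)
          rw [hr]; exact haq
      exact Option.map_injective Subtype.val_injective (h1.unique h3)
  have hopt : ∀ o : Option {p // p ∈ F},
      H'.optHeight K ((Option.map φ o).map (↑)) = H.optHeight K (o.map (↑)) := by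
    rintro (_ | a)
    · rfl
    · exact hh a
  have hiso : IsTreeIso T.toRootedTree T'.toRootedTree
      ((e.trans (Equiv.optionCongr φ)).trans e'.symm) := by
    refine ⟨?_, fun u => ?_⟩
    · have h2 : e'.symm none = T'.root := e'.symm_apply_eq.2 hT'.root.symm
      simp [hT.root, h2]
    · have := hpar u
      simp only [Equiv.trans_apply, Equiv.optionCongr_apply]
      rw [Equiv.symm_apply_eq, this]
  refine (EditStep.iso _ _ _ hiso fun u hu => ?_).editLE
  have hne : ((e.trans (Equiv.optionCongr φ)).trans e'.symm) u ≠ T'.root := by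
    intro h
    rw [← hiso.1] at h
    exact hu (Equiv.injective _ h)
  rw [hT'.weight _ hne, hT.weight u hu]
  simp only [Equiv.trans_apply, Equiv.optionCongr_apply, Equiv.apply_symm_apply]
  rw [hpar, hopt, hopt]

lemma weight_le_of_mem {F : Finset α} {K : ℝ} (hK : ∀ q ∈ F, H.h q < K) (p : {p // p ∈ F})
    {q : α} (hq : q ∈ F) (hpq : H.R p q) :
    (H.tree F K hK).weight (some p) ≤ H.h q - H.h p := by
  have h1 := H.father_isLowestAbove F p
  simp only
  rcases hf : H.father F (some p) with _ | b
  · rw [hf] at h1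
    exact absurd hpq (h1 q hq)
  · rw [hf] at h1
    exact sub_le_sub_right (h1.2.2 q hq hpq) _

section Removal

variable [DecidableEq α] {H}

/-- The inclusion of the vertices after removal of `p`. -/
def eraseIncl (F : Finset α) (p : α) : Option {q // q ∈ F.erase p} → Option {q // q ∈ F} :=
  Option.map fun q => ⟨q, Finset.mem_of_mem_erase q.2⟩

lemma eraseIncl_map (F : Finset α) (p : α) (o : Option {q // q ∈ F.erase p}) :
    (eraseIncl F p o).map (↑) = o.map ((↑) : _ → α) := by
  rcases o with _ | a <;> rfl

/-- When `p` is removed, elements directly below `p` pass to the lowest element above `p`. -/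
lemma IsLowestAbove.erase {F : Finset α} {a p : α} {o o' : Option α}
    (ho : H.IsLowestAbove F a o) (hp : H.IsLowestAbove F p o') :
    H.IsLowestAbove (F.erase p) a (if o = some p then o' else o) := by
  split_ifs with h
  · subst h
    rcases o' with _ | b
    · intro q hq haq
      rw [Finset.mem_erase] at hq
      rcases H.chain ho.2.1 haq (ho.2.2 q hq.2 haq) with h | h
      · exact hq.1 h.symm
      · exact hp q hq.2 h
    · refine ⟨Finset.mem_erase.2 ⟨fun h => ?_, hp.1⟩, H.trans ho.2.1 hp.2.1, fun q hq haq => ?_⟩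
      · exact absurd (H.lt hp.2.1) (by simp [h])
      · rw [Finset.mem_erase] at hq
        rcases H.chain ho.2.1 haq (ho.2.2 q hq.2 haq) with h | h
        · exact absurd h.symm hq.1
        · exact hp.2.2 q hq.2 h
  · rcases o with _ | b
    · exact fun q hq => ho q (Finset.mem_of_mem_erase hq)
    · exact ⟨Finset.mem_erase.2 ⟨fun hb => h (by rw [hb]), ho.1⟩, ho.2.1,
        fun q hq => ho.2.2 q (Finset.mem_of_mem_erase hq)⟩

lemma eraseIncl_father (F : Finset α) (p : {p // p ∈ F}) (u : Option {q // q ∈ F.erase p}) :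
    eraseIncl F p (H.father (F.erase p) u) =
      if H.father F (eraseIncl F p u) = some p then H.father F (some p)
        else H.father F (eraseIncl F p u) := by
  rcases u with _ | a
  · rfl
  · apply Option.map_injective Subtype.val_injective
    have h1 := (H.father_isLowestAbove F ⟨a, Finset.mem_of_mem_erase a.2⟩).erase
      (H.father_isLowestAbove F p)
    have h2 := H.father_isLowestAbove (F.erase p) a
    change ((eraseIncl F p (H.father (F.erase p) (some a))).map ((↑) : _ → α)) = _
    rw [eraseIncl_map, h2.unique h1, apply_ite (Option.map Subtype.val)]
    have h3 : (Option.map Subtype.val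
        (H.father F (some ⟨a, Finset.mem_of_mem_erase a.2⟩)) = some (p : α)) ↔
        H.father F (some ⟨a, Finset.mem_of_mem_erase a.2⟩) = some p := by
      rw [← Option.map_some (f := Subtype.val)]
      exact (Option.map_injective Subtype.val_injective).eq_iff
    simp only [h3]
    rfl

variable {F : Finset α} {K : ℝ} (hK : ∀ q ∈ F, H.h q < K)

lemma isVertexRemoval_erase (p : {p // p ∈ F}) (hK' : ∀ q ∈ F.erase p, H.h q < K) :
    IsVertexRemoval (H.tree F K hK).toRootedTree (H.tree (F.erase p) K hK').toRootedTree
      (some p) (eraseIncl F p) := by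
  refine ⟨by simp [tree], ?_, ?_, rfl, fun u => ?_⟩
  · refine Option.map_injective fun a b h => Subtype.ext ?_
    simpa using h
  · ext o
    rcases o with _ | a
    · exact ⟨fun _ => by simp, fun _ => ⟨none, rfl⟩⟩
    · simp only [mem_range, mem_compl_iff, mem_singleton_iff, Option.some.injEq]
      constructor
      · rintro ⟨_ | b, hb⟩ h
        · simp [eraseIncl] at hb
        · subst h
          simp only [eraseIncl, Option.map_some, Option.some.injEq] at hb
          exact Finset.ne_of_mem_erase b.2 (congrArg Subtype.val hb)
      · intro h
        exact ⟨some ⟨a, Finset.mem_erase.2 ⟨fun h' => h (Subtype.ext h'), a.2⟩⟩, rfl⟩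
  · refine (eraseIncl_father F p u).trans ?_
    congr

/-- The weights after the removal of `p`: the edges of its children grow by the edge of `p`. -/
lemma weight_erase (p : {p // p ∈ F}) (hK' : ∀ q ∈ F.erase p, H.h q < K)
    (u : Option {q // q ∈ F.erase p}) :
    (H.tree (F.erase p) K hK').weight u =
      if H.father F (eraseIncl F p u) = some p
      then (H.tree F K hK).weight (eraseIncl F p u) + (H.tree F K hK).weight (some p)
      else (H.tree F K hK).weight (eraseIncl F p u) := by
  simp only
  rw [← eraseIncl_map F p (H.father _ u), ← eraseIncl_map F p u, eraseIncl_father]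
  split_ifs with h
  · rw [h]
    ring
  · rfl

/-- The hypothesis on `p` says that `c` is its only child: it is the highest element below `p`, and
all others are below `c`. -/
lemma editLE_erase_ghost (p : {p // p ∈ F}) (hK' : ∀ q ∈ F.erase p, H.h q < K)
    (hp : ∃ c ∈ F, H.R c p ∧ ∀ r ∈ F, H.R r p → r = c ∨ H.R r c) :
    EditLE (H.tree F K hK) (H.tree (F.erase p) K hK') 0 := by
  obtain ⟨c, hc, hcp, hall⟩ := hp
  have hchild : ∀ u : Option {p // p ∈ F}, H.father F u = some p ↔ u = some ⟨c, hc⟩ := by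
    intro u
    constructor
    · intro h
      rcases u with _ | a
      · exact absurd h (by simp [father])
      · have h1 := H.father_isLowestAbove F a
        rw [h] at h1
        rcases hall a a.2 h1.2.1 with h2 | h2
        · exact congrArg some (Subtype.ext h2)
        · exact absurd (h1.2.2 c hc h2) (not_le.2 (H.lt hcp))
    · rintro rfl
      apply Option.map_injective Subtype.val_injective
      refine (H.father_isLowestAbove F ⟨c, hc⟩).unique ⟨p.2, hcp, fun r hr hcr => ?_⟩
      by_contra hlt
      push Not at hlt
      rcases H.chain hcr hcp hlt.le with h | h
      · exact absurd hlt (by simp [h])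
      · rcases hall r hr h with h' | h'
        · exact absurd (H.lt hcr) (by simp [h'])
        · exact absurd (H.lt hcr) (not_lt.2 (H.lt h').le)
  refine (EditStep.ghost _ _ (some p) ⟨some ⟨c, hc⟩, hchild, eraseIncl F p,
    isVertexRemoval_erase hK p hK', fun u _ => ?_⟩).editLE
  rw [weight_erase hK p hK' u]
  simp only [hchild]
  by_cases h : eraseIncl F p u = some ⟨c, hc⟩
  · rw [if_pos h, if_pos h, h]
  · rw [if_neg h, if_neg h]

/-- Enlarging the edges of the children of `p` and then deleting `p`. -/
lemma editLE_erase_delete (p : {p // p ∈ F}) (hK' : ∀ q ∈ F.erase p, H.h q < K) {q : α}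
    (hq : q ∈ F) (hpq : H.R p q) {η : ℝ} (hη : H.h q - H.h p ≤ η) :
    EditLE (H.tree F K hK) (H.tree (F.erase p) K hK') ((F.card + 2) * η) := by
  classical
  set T := H.tree F K hK with hT
  have hwp : T.weight (some p) ≤ η := (H.weight_le_of_mem hK p hq hpq).trans hη
  have hwpos : 0 < T.weight (some p) := T.weight_pos _ (by simp)
  set w : T.V → ℝ := fun u =>
    if H.father F u = some p then T.weight u + T.weight (some p) else T.weight u with hw
  have hpos : ∀ v, v ≠ T.root → 0 < w v := by
    intro v hv
    have := T.weight_pos v hv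
    simp only [hw]
    split_ifs <;> linarith
  have hpp : H.father F (some p) ≠ some p := by
    intro h
    have h1 := H.father_isLowestAbove F p
    rw [h] at h1
    exact lt_irrefl _ (H.lt h1.2.1)
  -- counting all edges as changed costs only a constant factor
  let A : Finset (Option {p // p ∈ F}) := Finset.univ
  have hA : (A.card : ℝ) = F.card + 1 := by
    simp [A, Fintype.card_option]
  have h1 := editLE_reweight T η (hwpos.le.trans hwp) A w hpos
    (fun v hv => absurd (Finset.mem_univ _) hv)
    (fun v => by
      simp only [hw]
      split_ifs
      · rw [add_sub_cancel_left, abs_of_pos hwpos]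
        exact hwp
      · simpa using hwpos.le.trans hwp)
  have h2 : EditLE { T with weight := w, weight_pos := hpos } (H.tree (F.erase p) K hK')
      (w (some p)) :=
    (EditStep.delete { T with weight := w, weight_pos := hpos } _ (some p)
      ⟨eraseIncl F p, isVertexRemoval_erase hK p hK', fun u _ => weight_erase hK p hK' u⟩).editLE
  have h3 : w (some p) = T.weight (some p) := if_neg hpp
  refine (h1.trans h2).mono ?_
  rw [hA, h3]
  linarith

/-- Vertices with exactly one child can be dropped at no cost. -/
lemma editLE_of_ghosts {G : Finset α} (n : ℕ) :
    ∀ (F : Finset α) (hK : ∀ q ∈ F, H.h q < K) (hKG : ∀ q ∈ G, H.h q < K), G ⊆ F →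
      (F \ G).card = n →
      (∀ p ∈ F, p ∉ G → ∃ c ∈ F, H.R c p ∧ ∀ r ∈ F, H.R r p → r = c ∨ H.R r c) →
      EditLE (H.tree F K hK) (H.tree G K hKG) 0 := by
  induction n with
  | zero =>
    intro F hK hKG hGF hn _
    have : F = G := (Finset.sdiff_eq_empty_iff_subset.1 (Finset.card_eq_zero.1 hn)).antisymm hGF
    subst this
    exact EditLE.refl _
  | succ n ih =>
    intro F hK hKG hGF hn hall
    obtain ⟨p, hp⟩ := Finset.card_pos.1 (by omega : 0 < (F \ G).card)
    have hp' := Finset.mem_sdiff.1 hp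
    have h1 := editLE_erase_ghost hK ⟨p, hp'.1⟩
      (fun q hq => hK q (Finset.mem_of_mem_erase hq)) (hall p hp'.1 hp'.2)
    have h2 := ih (F.erase p) (fun q hq => hK q (Finset.mem_of_mem_erase hq)) hKG
      (fun q hq => Finset.mem_erase.2 ⟨fun h => hp'.2 (h ▸ hq), hGF hq⟩)
      (by rw [Finset.erase_sdiff_comm, Finset.card_erase_of_mem hp, hn]; rfl) (by
        intro q hq hqG
        rw [Finset.mem_erase] at hq
        obtain ⟨c, hc, hcq, hcall⟩ := hall q hq.2 hqG
        by_cases hcp : c = p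
        · -- the child of `q` has just been removed, and is replaced by its own child
          subst hcp
          obtain ⟨c', hc', hcc', hcall'⟩ := hall c hp'.1 hp'.2
          refine ⟨c', Finset.mem_erase.2 ⟨fun h => ?_, hc'⟩, H.trans hcc' hcq, fun r hr hrq => ?_⟩
          · exact absurd (H.lt hcc') (by simp [h])
          · rw [Finset.mem_erase] at hr
            exact hcall' r hr.2 ((hcall r hr.2 hrq).resolve_left hr.1)
        · exact ⟨c, Finset.mem_erase.2 ⟨hcp, hc⟩, hcq, fun r hr =>
            hcall r (Finset.mem_of_mem_erase hr)⟩)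
    simpa using h1.trans h2

/-- Vertices that have a vertex of `G` at most `η` above them can be deleted at a total cost
linear in `η`. -/
lemma editLE_of_deletions {G : Finset α} {η : ℝ} (hη : 0 ≤ η) (n : ℕ) :
    ∀ (F : Finset α) (hK : ∀ q ∈ F, H.h q < K) (hKG : ∀ q ∈ G, H.h q < K), G ⊆ F →
      (F \ G).card = n → (∀ p ∈ F, p ∉ G → ∃ q ∈ G, H.R p q ∧ H.h q - H.h p ≤ η) →
      EditLE (H.tree F K hK) (H.tree G K hKG) (n * ((F.card + 2) * η)) := by
  induction n with
  | zero =>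
    intro F hK hKG hGF hn _
    have : F = G := (Finset.sdiff_eq_empty_iff_subset.1 (Finset.card_eq_zero.1 hn)).antisymm hGF
    subst this
    simpa using EditLE.refl _
  | succ n ih =>
    intro F hK hKG hGF hn hall
    obtain ⟨p, hp⟩ := Finset.card_pos.1 (by omega : 0 < (F \ G).card)
    have hp' := Finset.mem_sdiff.1 hp
    obtain ⟨q, hq, hpq, hqη⟩ := hall p hp'.1 hp'.2
    have h1 := editLE_erase_delete hK ⟨p, hp'.1⟩
      (fun q hq => hK q (Finset.mem_of_mem_erase hq)) (hGF hq) hpq hqη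
    have h2 := ih (F.erase p) (fun q hq => hK q (Finset.mem_of_mem_erase hq)) hKG
      (fun q hq => Finset.mem_erase.2 ⟨fun h => hp'.2 (h ▸ hq), hGF hq⟩)
      (by rw [Finset.erase_sdiff_comm, Finset.card_erase_of_mem hp, hn]; rfl)
      (fun r hr => hall r (Finset.mem_of_mem_erase hr))
    refine (h1.trans h2).mono ?_
    have h3 : ((F.erase p).card : ℝ) ≤ F.card := by
      exact_mod_cast Finset.card_le_card (Finset.erase_subset p F)
    have h4 : (n : ℝ) * (((F.erase p).card + 2) * η) ≤ n * ((F.card + 2) * η) := by gcongr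
    push_cast
    linarith

end Removal

end HeightForest

/-! ### Levels without topological change -/

section Levels

variable {X : Type} [TopologicalSpace X] {f g : X → ℝ}

lemma exists_comps_superset_of_subset {s t : ℝ} (h : sublevel f s ⊆ sublevel g t) {U : Set X}
    (hU : U ∈ comps f s) : ∃ V ∈ comps g t, U ⊆ V := by
  obtain ⟨x, hx, rfl⟩ := hU
  exact ⟨_, ⟨x, h hx, rfl⟩, pathComponentIn_mono h⟩

lemma comps_eq_of_subset {t : ℝ} {U V W : Set X} (hV : V ∈ comps f t) (hW : W ∈ comps f t)
    (hU : U.Nonempty) (hUV : U ⊆ V) (hUW : U ⊆ W) : V = W := by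
  obtain ⟨x, hx⟩ := hU
  exact comps_eq_of_mem hV hW (hUV hx) (hUW hx)

lemma InclBijective.eq_of_subset {s t : ℝ} (h : InclBijective f s t) {U V W : Set X}
    (hU : U ∈ comps f s) (hV : V ∈ comps f s) (hW : W ∈ comps f t) (hUW : U ⊆ W) (hVW : V ⊆ W) :
    U = V :=
  (h W hW).unique ⟨hU, hUW⟩ ⟨hV, hVW⟩

lemma InclBijective.refl (f : X → ℝ) (t : ℝ) : InclBijective f t t := fun V hV =>
  ⟨V, ⟨hV, Subset.rfl⟩, fun _ hU =>
    comps_eq_of_subset hU.1 hV (comps_nonempty hU.1) Subset.rfl hU.2⟩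

lemma InclBijective.of_comp {r s t : ℝ} (hrs : r ≤ s) (hst : s ≤ t) (h1 : InclBijective f r s)
    (h2 : InclBijective f r t) : InclBijective f s t := by
  intro W hW
  obtain ⟨U, ⟨hU, hUW⟩, -⟩ := h2 W hW
  have key : ∀ V, V ∈ comps f s ∧ V ⊆ W → U ⊆ V := by
    rintro V ⟨hV, hVW⟩
    obtain ⟨U', ⟨hU', hUV'⟩, -⟩ := h1 V hV
    rwa [h2.eq_of_subset hU hU' hW hUW (hUV'.trans hVW)]
  obtain ⟨V, hV, hUV⟩ := exists_comps_superset hrs hU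
  obtain ⟨W', hW', hVW'⟩ := exists_comps_superset hst hV
  rw [← comps_eq_of_subset hW hW' (comps_nonempty hU) hUW (hUV.trans hVW')] at hVW'
  exact ⟨V, ⟨hV, hVW'⟩, fun V' hV' =>
    comps_eq_of_subset hV'.1 hV (comps_nonempty hU) (key V' hV') hUV⟩

/-- By regularity, the topology of the sublevel sets changes at the critical values only, and not
immediately above them. -/
lemma HasMergeTree.inclBijective (h : HasMergeTree f) {s t : ℝ} (hst : s ≤ t)
    (hc : ∀ c ∈ criticalValues f, c ∉ Ioc s t) : InclBijective f s t := by
  obtain ⟨C, hC, hCe⟩ := h.tame.exists_criticalValues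
  have hCm : ∀ c ∈ C, c ∈ criticalValues f := fun c hc => by
    rw [← hCe]
    exact hc
  rcases hst.eq_or_lt with rfl | hlt
  · exact .refl f s
  by_cases hs : s ∈ criticalValues f
  · obtain ⟨D, hD, hDε⟩ := h.regular s hs
    have hpos : 0 < min D (t - s) := lt_min hD (by linarith)
    have hle : s + min D (t - s) / 2 ≤ t := by linarith [min_le_right D (t - s)]
    refine (hDε (min D (t - s) / 2) (by linarith)
      (by linarith [min_le_left D (t - s)])).trans (by linarith) hle (hC _ _ hle ?_)
    exact fun c hcC hc' => hc c (hCm c hcC) ⟨by linarith [hc'.1], hc'.2⟩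
  · refine hC s t hst fun c hcC hc' => ?_
    rcases hc'.1.eq_or_lt with rfl | hsc
    · exact hs (hCm _ hcC)
    · exact hc c (hCm c hcC) ⟨hsc, hc'.2⟩

/-- Below all critical values the sublevel sets are empty. -/
lemma HasMergeTree.exists_criticalValue_le (h : HasMergeTree f) {t : ℝ} {U : Set X}
    (hU : U ∈ comps f t) : ∃ c ∈ criticalValues f, c ≤ t := by
  by_contra! hc
  obtain ⟨m, hm⟩ := h.bddBelow
  have hb := h.inclBijective (min_le_right (m - 1) t) fun c hcc hc' => (hc c hcc).not_ge hc'.2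
  obtain ⟨V, ⟨⟨x, hx, -⟩, -⟩, -⟩ := hb U hU
  have h1 : f x ≤ m - 1 := le_trans hx (min_le_left _ _)
  have h2 : m ≤ f x := hm ⟨x, rfl⟩
  linarith

lemma HasMergeTree.finite_criticalValues (h : HasMergeTree f) : (criticalValues f).Finite := by
  obtain ⟨C, -, hCe⟩ := h.tame.exists_criticalValues
  rw [← hCe]
  exact C.finite_toSet

lemma exists_isPrevCritical (h : (criticalValues f).Finite) {c t : ℝ}
    (hc : c ∈ criticalValues f) (hct : c < t) : ∃ s, IsPrevCritical f s t := by
  obtain ⟨s, hs, hmax⟩ := Set.exists_max_image (criticalValues f ∩ Iio t) id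
    (h.subset inter_subset_left) ⟨c, hc, hct⟩
  exact ⟨s, hs.1, hs.2, fun r hr hrt => hmax r ⟨hr, hrt⟩⟩

/-- A component that carries no vertex contains exactly one component of the preceding critical
level. -/
lemma existsUnique_of_not_isVertex {t : ℝ} {U : Set X} (ht : t ∈ criticalValues f)
    (hU : U ∈ comps f t) (h : ¬ IsVertex f (t, U)) :
    ∃ s, IsPrevCritical f s t ∧ ∃! V, V ∈ comps f s ∧ V ⊆ U := by
  simp only [IsVertex, ht, hU, true_and, not_or, not_forall, not_not] at h
  obtain ⟨⟨s, hs, V, hV, hVU⟩, h2⟩ := h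
  refine ⟨s, hs, V, ⟨hV, hVU⟩, fun W hW => ?_⟩
  by_contra hne
  exact h2 ⟨s, hs, W, hW.1, V, hV, hne, hW.2, hVU⟩

/-- Every critical value is the height of a vertex. -/
lemma HasMergeTree.exists_node (h : HasMergeTree f) {c : ℝ} (hc : c ∈ criticalValues f) :
    ∃ p : Node f, p.1.1 = c := by
  classical
  by_contra! hno
  have hno' : ∀ U, ¬ IsVertex f (c, U) := fun U hU => hno ⟨_, hU⟩ rfl
  obtain ⟨C, hC, hCe⟩ := h.tame.exists_criticalValues
  have hCm : ∀ r, r ∈ C ↔ r ∈ criticalValues f := fun r => by rw [← hCe, Finset.mem_coe]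
  -- then `c` is superfluous in the smallest critical set
  refine Finset.notMem_erase c C (hc _ ?_)
  intro t t' htt' hav
  have hav' : ∀ r ∈ criticalValues f, r ∈ Icc t t' → r = c := by
    intro r hr hr'
    by_contra hrc
    exact hav r (Finset.mem_erase.2 ⟨hrc, (hCm r).2 hr⟩) hr'
  by_cases hct : c ∈ Icc t t'
  swap
  · exact h.inclBijective htt' fun r hr hr' =>
      hct (hav' r hr ⟨hr'.1.le, hr'.2⟩ ▸ ⟨hr'.1.le, hr'.2⟩)
  have h2 : InclBijective f c t' := h.inclBijective hct.2 fun r hr hr' =>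
    hr'.1.ne' (hav' r hr ⟨hct.1.trans hr'.1.le, hr'.2⟩)
  refine InclBijective.trans hct.1 hct.2 ?_ h2
  rcases hct.1.eq_or_lt with rfl | htc
  · exact .refl f _
  intro U hU
  obtain ⟨s, hs, -⟩ := existsUnique_of_not_isVertex hc hU (hno' U)
  have hst : s < t := by
    by_contra! hts
    exact hs.2.1.ne (hav' s hs.1 ⟨hts, hs.2.1.le.trans hct.2⟩)
  refine InclBijective.of_comp hst.le htc.le ?_ ?_ U hU
  · exact h.inclBijective hst.le fun r hr hr' =>
      hr'.1.not_ge (hs.2.2 r hr (hr'.2.trans_lt htc))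
  · intro V hV
    obtain ⟨s', hs', hV'⟩ := existsUnique_of_not_isVertex hc hV (hno' V)
    rwa [(hs.2.2 s' hs'.1 hs'.2.1).antisymm (hs'.2.2 s hs.1 hs.2.1)] at hV'

end Levels

/-! ### The level trees of a function -/

section LevelTree

variable {X : Type} [TopologicalSpace X] {f : X → ℝ}

/-- The components of all sublevel sets, together with their levels. -/
abbrev Piece (f : X → ℝ) : Type := {p : ℝ × Set X // p.2 ∈ comps f p.1}

/-- The components of all sublevel sets, ordered by level and inclusion. -/
def pieceForest (f : X → ℝ) : HeightForest (Piece f) where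
  h p := p.1.1
  R p q := p.1.1 < q.1.1 ∧ p.1.2 ⊆ q.1.2
  lt h := h.1
  trans h h' := ⟨h.1.trans h'.1, h.2.trans h'.2⟩
  chain := by
    rintro ⟨⟨s, U⟩, hU⟩ ⟨⟨t, V⟩, hV⟩ ⟨⟨t', V'⟩, hV'⟩ ⟨-, h1⟩ ⟨-, h2⟩ h
    simp only at h h1 h2 hU hV hV'
    obtain ⟨W, hW, hVW⟩ := exists_comps_superset h hV
    have : W = V' := comps_eq_of_subset hW hV' (comps_nonempty hU) (h1.trans hVW) h2
    subst this
    rcases h.eq_or_lt with rfl | hlt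
    · have : V = W := comps_eq_of_subset hV hW (comps_nonempty hU) h1 h2
      subst this
      exact Or.inl rfl
    · exact Or.inr ⟨hlt, hVW⟩

open Classical in
/-- The components of the sublevel sets at the levels in `Λ`. -/
noncomputable def pieces (h : ∀ t, (comps f t).Finite) (Λ : Finset ℝ) : Finset (Piece f) :=
  Λ.biUnion fun s => (h s).toFinset.attach.image
    fun U : {U // U ∈ (h s).toFinset} => ⟨(s, U.1), (h s).mem_toFinset.1 U.2⟩

lemma mem_pieces {h : ∀ t, (comps f t).Finite} {Λ : Finset ℝ} {p : Piece f} :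
    p ∈ pieces h Λ ↔ p.1.1 ∈ Λ := by
  simp only [pieces, Finset.mem_biUnion, Finset.mem_image, Finset.mem_attach, true_and]
  constructor
  · rintro ⟨s, hs, U, rfl⟩
    exact hs
  · intro hp
    exact ⟨p.1.1, hp, ⟨p.1.2, (h _).mem_toFinset.2 p.2⟩, rfl⟩

lemma card_pieces_le {h : ∀ t, (comps f t).Finite} {N : ℕ} (hN : ∀ t, (comps f t).ncard ≤ N)
    (Λ : Finset ℝ) : (pieces h Λ).card ≤ Λ.card * N := by
  classical
  refine Finset.card_biUnion_le_card_mul _ _ _ fun s _ => Finset.card_image_le.trans ?_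
  rw [Finset.card_attach, ← Set.ncard_eq_toFinset_card _ (h s)]
  exact hN s

open Classical in
/-- The vertices of the merge tree among the components at the levels in `Λ`. -/
noncomputable def nodePieces (h : ∀ t, (comps f t).Finite) (Λ : Finset ℝ) : Finset (Piece f) :=
  (pieces h Λ).filter fun p => IsVertex f p.1

lemma mem_nodePieces {h : ∀ t, (comps f t).Finite} {Λ : Finset ℝ}
    (hΛ : criticalValues f ⊆ Λ) {p : Piece f} : p ∈ nodePieces h Λ ↔ IsVertex f p.1 := by
  simp only [nodePieces, Finset.mem_filter, mem_pieces]
  exact ⟨fun h => h.2, fun h => ⟨hΛ h.1, h⟩⟩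

/-- The vertices of the merge tree as components of sublevel sets. -/
noncomputable def nodeEquiv (h : ∀ t, (comps f t).Finite) (Λ : Finset ℝ)
    (hΛ : criticalValues f ⊆ Λ) : Node f ≃ {p // p ∈ nodePieces h Λ} where
  toFun p := ⟨⟨p.1, p.2.2.1⟩, (mem_nodePieces hΛ).2 p.2⟩
  invFun p := ⟨p.1.1, (mem_nodePieces hΛ).1 p.2⟩
  left_inv _ := rfl
  right_inv _ := rfl

lemma mergeTree_realizes (h : HasMergeTree f) {K : ℝ} (hK : (mergeTree f h).IsBelow K)
    (Λ : Finset ℝ) (hΛ : criticalValues f ⊆ Λ) :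
    (pieceForest f).Realizes (nodePieces h.tame.2 Λ) K ((mergeTree f h).truncate K hK)
      (Equiv.optionCongr (nodeEquiv h.tame.2 Λ hΛ)) where
  root := rfl
  parent := by
    rintro (_ | p) q hpq
    · exact (Option.some_ne_none q hpq.symm).elim
    obtain rfl : nodeEquiv h.tame.2 Λ hΛ p = q := Option.some_injective _ hpq
    rcases father_spec h.tame.finite_node p with ⟨h1, h2⟩ | ⟨q, h1, h2⟩
    · change HeightForest.IsLowestAbove _ _ _ (Option.map _ (Option.map _ (father f (some p))))
      rw [h1]
      exact fun r hr hpr => h2 ⟨r.1, (mem_nodePieces hΛ).1 hr⟩ hpr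
    · change HeightForest.IsLowestAbove _ _ _ (Option.map _ (Option.map _ (father f (some p))))
      rw [h1]
      exact ⟨(nodeEquiv h.tame.2 Λ hΛ q).2, h2.1, fun r hr hpr =>
        h2.2 ⟨r.1, (mem_nodePieces hΛ).1 hr⟩ hpr⟩
  weight := by
    have hh : ∀ v : Option (Node f), (mergeTree f h).truncHeight K v =
        (pieceForest f).optHeight K
          ((Option.map (nodeEquiv h.tame.2 Λ hΛ) v).map (↑)) := by
      rintro (_ | p)
      · exact if_pos rfl
      · exact if_neg (Option.some_ne_none p)
    intro v _
    exact congrArg₂ (· - ·) (hh _) (hh v)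

/-- The merge tree arises from the level tree by ghosting: a component that carries no vertex
contains exactly one component of the level below. -/
lemma editLE_mergeTree_pieces (h : HasMergeTree f) {K : ℝ} (hK : (mergeTree f h).IsBelow K)
    (Λ : Finset ℝ) (hΛ : criticalValues f ⊆ Λ)
    (hK' : ∀ p ∈ pieces h.tame.2 Λ, (pieceForest f).h p < K) :
    EditLE ((mergeTree f h).truncate K hK) ((pieceForest f).tree (pieces h.tame.2 Λ) K hK') 0 := by
  classical
  have hsub : nodePieces h.tame.2 Λ ⊆ pieces h.tame.2 Λ := Finset.filter_subset _ _
  have h1 : EditLE ((mergeTree f h).truncate K hK)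
      ((pieceForest f).tree (nodePieces h.tame.2 Λ) K fun q hq => hK' q (hsub hq)) 0 :=
    HeightForest.editLE_of_realizes (mergeTree_realizes h hK Λ hΛ)
      ((pieceForest f).tree_realizes _ K _) (Equiv.refl _) (fun _ => rfl) fun _ _ => Iff.rfl
  have h2 := HeightForest.editLE_of_ghosts _ (pieces h.tame.2 Λ) hK'
    (fun q hq => hK' q (hsub hq)) hsub rfl (by
      rintro ⟨⟨t, U⟩, hU⟩ hp hpG
      rw [mem_nodePieces hΛ] at hpG
      rw [mem_pieces] at hp
      simp only at hU hp hpG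
      -- `s` is a critical value below `t` from whose level on nothing happens below `t`
      obtain ⟨s, hs, hst, hmax, huniq⟩ : ∃ s ∈ criticalValues f, s < t ∧
          (∀ c ∈ criticalValues f, c < t → c ≤ s) ∧ ∃! V, V ∈ comps f s ∧ V ⊆ U := by
        by_cases ht : t ∈ criticalValues f
        · obtain ⟨s, hs, hV⟩ := existsUnique_of_not_isVertex ht hU hpG
          exact ⟨s, hs.1, hs.2.1, hs.2.2, hV⟩
        · obtain ⟨c, hc, hct⟩ := h.exists_criticalValue_le hU
          have hct' : c < t := hct.lt_of_ne fun h => ht (h ▸ hc)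
          obtain ⟨s, hs⟩ := exists_isPrevCritical h.finite_criticalValues hc hct'
          refine ⟨s, hs.1, hs.2.1, hs.2.2, h.inclBijective hs.2.1.le (fun r hr hr' => ?_) U hU⟩
          have hrt : r < t := hr'.2.lt_of_ne fun h => ht (h ▸ hr)
          exact hr'.1.not_ge (hs.2.2 r hr hrt)
      -- `s'` is the level of `Λ` just below `t`
      obtain ⟨s', hs', hs'max⟩ := Finset.exists_max_image (Λ.filter (· < t)) id
        ⟨s, Finset.mem_filter.2 ⟨hΛ hs, hst⟩⟩
      rw [Finset.mem_filter] at hs'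
      have hss' : s ≤ s' := hs'max s (Finset.mem_filter.2 ⟨hΛ hs, hst⟩)
      have hbij : InclBijective f s s' := h.inclBijective hss' fun c hc hc' =>
        hc'.1.not_ge (hmax c hc (hc'.2.trans_lt hs'.2))
      have huniq' : ∀ V ∈ comps f s', ∀ W ∈ comps f s', V ⊆ U → W ⊆ U → V = W := by
        intro V hV W hW hVU hWU
        obtain ⟨V₀, ⟨hV₀, hVV⟩, -⟩ := hbij V hV
        obtain ⟨W₀, ⟨hW₀, hWW⟩, -⟩ := hbij W hW
        have := huniq.unique ⟨hV₀, hVV.trans hVU⟩ ⟨hW₀, hWW.trans hWU⟩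
        subst this
        exact comps_eq_of_subset hV hW (comps_nonempty hV₀) hVV hWW
      obtain ⟨V₀, ⟨hV₀, hV₀U⟩, -⟩ := huniq
      obtain ⟨V, hV, hV₀V⟩ := exists_comps_superset hss' hV₀
      have hsubU : ∀ r ≤ s', ∀ W ∈ comps f r, W ⊆ U → ∃ W' ∈ comps f s', W ⊆ W' ∧ W' ⊆ U := by
        intro r hr W hW hWU
        obtain ⟨W', hW', hWW'⟩ := exists_comps_superset hr hW
        obtain ⟨U', hU', hWU'⟩ := exists_comps_superset hs'.2.le hW'
        rw [← comps_eq_of_subset hU hU' (comps_nonempty hW) hWU (hWW'.trans hWU')] at hWU'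
        exact ⟨W', hW', hWW', hWU'⟩
      have hVU : V ⊆ U := by
        obtain ⟨V', hV', hV₀V', hV'U⟩ := hsubU s hss' V₀ hV₀ hV₀U
        rwa [comps_eq_of_subset hV hV' (comps_nonempty hV₀) hV₀V hV₀V']
      refine ⟨⟨(s', V), hV⟩, mem_pieces.2 hs'.1, ⟨hs'.2, hVU⟩, ?_⟩
      rintro ⟨⟨r, W⟩, hW⟩ hr ⟨hrt, hWU⟩
      rw [mem_pieces] at hr
      simp only at hrt hWU hW hr
      have hrs' : r ≤ s' := hs'max r (Finset.mem_filter.2 ⟨hr, hrt⟩)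
      obtain ⟨W', hW', hWW', hW'U⟩ := hsubU r hrs' W hW hWU
      obtain rfl := huniq' V hV W' hW' hVU hW'U
      rcases hrs'.eq_or_lt with rfl | hlt
      · left
        obtain rfl := comps_eq_of_subset hW hW' (comps_nonempty hW) Subset.rfl hWW'
        rfl
      · exact Or.inr ⟨hlt, hWW'⟩)
  simpa using h1.trans h2.symm

end LevelTree

/-! ### Matching the components of two close functions -/

section Matching

variable {X : Type} [TopologicalSpace X] {f g : X → ℝ} {δ b : ℝ}

/-- No topological change of the sublevel sets happens between the levels `b` and `b + 2 * δ`. -/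
def IsGap (f : X → ℝ) (δ b : ℝ) : Prop :=
  ∀ s t, b ≤ s → s ≤ t → t ≤ b + 2 * δ → InclBijective f s t

/-- The component `U` of `{f ≤ b}` corresponds to the component `V` of `{g ≤ b}`: they lie in one
component of `{g ≤ b + δ}`. -/
def Matched (g : X → ℝ) (δ b : ℝ) (U V : Set X) : Prop :=
  ∃ W ∈ comps g (b + δ), U ⊆ W ∧ V ⊆ W


lemma sublevel_subset_of_close {X : Type} {f g : X → ℝ} {δ : ℝ} (h : ∀ x, |f x - g x| ≤ δ)
    {s t : ℝ} (hst : s + δ ≤ t) : sublevel f s ⊆ sublevel g t := fun x hx => by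
  have h1 : f x ≤ s := hx
  have h2 := abs_le.1 (h x)
  show g x ≤ t
  linarith [h2.1]

lemma close_symm {X : Type} {f g : X → ℝ} {δ : ℝ} (h : ∀ x, |f x - g x| ≤ δ) (x : X) :
    |g x - f x| ≤ δ := by
  rw [abs_sub_comm]
  exact h x

lemma Matched.eq_right (hδ : 0 ≤ δ) (hg : IsGap g δ b) {U V V' : Set X} (hU : U.Nonempty)
    (hV : V ∈ comps g b) (hV' : V' ∈ comps g b) (h : Matched g δ b U V)
    (h' : Matched g δ b U V') : V = V' := by
  obtain ⟨W, hW, hUW, hVW⟩ := h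
  obtain ⟨W', hW', hUW', hVW'⟩ := h'
  obtain rfl := comps_eq_of_subset hW hW' hU hUW hUW'
  exact (hg b (b + δ) le_rfl (by linarith) (by linarith)).eq_of_subset hV hV' hW hVW hVW'

lemma Matched.eq_left (hδ : 0 ≤ δ) (hfg : ∀ x, |f x - g x| ≤ δ) (hf : IsGap f δ b)
    {U U' V : Set X} (hV : V.Nonempty) (hU : U ∈ comps f b) (hU' : U' ∈ comps f b)
    (h : Matched g δ b U V) (h' : Matched g δ b U' V) : U = U' := by
  obtain ⟨W, hW, hUW, hVW⟩ := h
  obtain ⟨W', hW', hUW', hVW'⟩ := h'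
  obtain rfl := comps_eq_of_subset hW hW' hV hVW hVW'
  obtain ⟨Z, hZ, hWZ⟩ := exists_comps_superset_of_subset
    (sublevel_subset_of_close (close_symm hfg) (by linarith : b + δ + δ ≤ b + 2 * δ)) hW
  exact (hf b (b + 2 * δ) le_rfl (by linarith) le_rfl).eq_of_subset hU hU' hZ
    (hUW.trans hWZ) (hUW'.trans hWZ)

lemma exists_matched_right (hδ : 0 ≤ δ) (hfg : ∀ x, |f x - g x| ≤ δ) (hg : IsGap g δ b)
    {U : Set X} (hU : U ∈ comps f b) : ∃ V ∈ comps g b, Matched g δ b U V := by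
  obtain ⟨W, hW, hUW⟩ := exists_comps_superset_of_subset
    (sublevel_subset_of_close hfg (le_refl (b + δ))) hU
  obtain ⟨V, ⟨hV, hVW⟩, -⟩ := hg b (b + δ) le_rfl (by linarith) (by linarith) W hW
  exact ⟨V, hV, W, hW, hUW, hVW⟩

lemma exists_matched_left (hδ : 0 ≤ δ) (hfg : ∀ x, |f x - g x| ≤ δ) (hf : IsGap f δ b)
    (hg : IsGap g δ b) {V : Set X} (hV : V ∈ comps g b) :
    ∃ U ∈ comps f b, Matched g δ b U V := by
  -- `V` lies in a component `U'` of `{f ≤ b + δ}`, which contains a component `U` of `{f ≤ b}`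
  obtain ⟨U', hU', hVU'⟩ := exists_comps_superset_of_subset
    (sublevel_subset_of_close (close_symm hfg) (le_refl (b + δ))) hV
  obtain ⟨U, ⟨hU, hUU'⟩, -⟩ := hf b (b + δ) le_rfl (by linarith) (by linarith) U' hU'
  obtain ⟨Z, hZ, hU'Z⟩ := exists_comps_superset_of_subset
    (sublevel_subset_of_close hfg (by linarith : b + δ + δ ≤ b + 2 * δ)) hU'
  -- the components of `{g ≤ b + δ}` that contain `U` and `V` merge below `b + 2 * δ`
  obtain ⟨W, hW, hUW⟩ := exists_comps_superset_of_subset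
    (sublevel_subset_of_close hfg (le_refl (b + δ))) hU
  obtain ⟨W', hW', hVW'⟩ := exists_comps_superset (by linarith : b ≤ b + δ) hV
  have hle : b + δ ≤ b + 2 * δ := by linarith
  obtain ⟨Y, hY, hWY⟩ := exists_comps_superset hle hW
  obtain ⟨Y', hY', hWY'⟩ := exists_comps_superset hle hW'
  obtain rfl := comps_eq_of_subset hY hZ (comps_nonempty hU) (hUW.trans hWY) (hUU'.trans hU'Z)
  obtain rfl := comps_eq_of_subset hY' hY (comps_nonempty hV) (hVW'.trans hWY')
    (hVU'.trans hU'Z)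
  obtain rfl := (hg (b + δ) (b + 2 * δ) (by linarith) hle le_rfl).eq_of_subset hW hW' hY hWY hWY'
  exact ⟨U, hU, W, hW, hUW, hVW'⟩

lemma Matched.mono (hδ : 0 ≤ δ) {b' : ℝ} (hbb' : b ≤ b') (hg : IsGap g δ b')
    {U V U' V' : Set X} (hU : U.Nonempty) (hV : V ∈ comps g b) (hV' : V' ∈ comps g b')
    (h : Matched g δ b U V) (h' : Matched g δ b' U' V') (hUU' : U ⊆ U') : V ⊆ V' := by
  obtain ⟨W, hW, hUW, hVW⟩ := h
  obtain ⟨W', hW', hUW', hVW'⟩ := h'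
  obtain ⟨Z, hZ, hWZ⟩ := exists_comps_superset (by linarith : b + δ ≤ b' + δ) hW
  obtain rfl := comps_eq_of_subset hZ hW' hU (hUW.trans hWZ) (hUU'.trans hUW')
  obtain ⟨V'', hV'', hVV''⟩ := exists_comps_superset hbb' hV
  obtain ⟨Y, hY, hVY⟩ := exists_comps_superset (by linarith : b' ≤ b' + δ) hV''
  obtain rfl := comps_eq_of_subset hZ hY (comps_nonempty hV) (hVW.trans hWZ) (hVV''.trans hVY)
  rwa [(hg b' (b' + δ) le_rfl (by linarith) (by linarith)).eq_of_subset hV' hV'' hZ hVW' hVY]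

lemma Matched.subset_iff (hδ : 0 ≤ δ) (hfg : ∀ x, |f x - g x| ≤ δ) {b' : ℝ} (hbb' : b ≤ b')
    (hf : IsGap f δ b') (hg : IsGap g δ b') {U V U' V' : Set X} (hU : U ∈ comps f b)
    (hV : V ∈ comps g b) (hU' : U' ∈ comps f b') (hV' : V' ∈ comps g b')
    (h : Matched g δ b U V) (h' : Matched g δ b' U' V') : U ⊆ U' ↔ V ⊆ V' := by
  refine ⟨h.mono hδ hbb' hg (comps_nonempty hU) hV hV' h', fun hVV' => ?_⟩
  obtain ⟨U'', hU'', hUU''⟩ := exists_comps_superset hbb' hU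
  obtain ⟨V'', hV'', h''⟩ := exists_matched_right hδ hfg hg hU''
  have hVV'' := h.mono hδ hbb' hg (comps_nonempty hU) hV hV'' h'' hUU''
  obtain rfl := comps_eq_of_subset hV' hV'' (comps_nonempty hV) hVV' hVV''
  rwa [h'.eq_left hδ hfg hf (comps_nonempty hV') hU' hU'' h'']

/-- The level trees of two close functions agree when all levels lie at the bottom of a common
gap. -/
lemma editLE_tree_pieces (hδ : 0 ≤ δ) (hfg : ∀ x, |f x - g x| ≤ δ)
    (hf : ∀ t, (comps f t).Finite) (hg : ∀ t, (comps g t).Finite) {S : Finset ℝ} {K : ℝ}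
    (hfS : ∀ b ∈ S, IsGap f δ b) (hgS : ∀ b ∈ S, IsGap g δ b)
    (hKf : ∀ p ∈ pieces hf S, (pieceForest f).h p < K)
    (hKg : ∀ p ∈ pieces hg S, (pieceForest g).h p < K) :
    EditLE ((pieceForest f).tree (pieces hf S) K hKf) ((pieceForest g).tree (pieces hg S) K hKg)
      0 := by
  have hex : ∀ p : {p // p ∈ pieces hf S}, ∃ q : {q // q ∈ pieces hg S},
      q.1.1.1 = p.1.1.1 ∧ Matched g δ p.1.1.1 p.1.1.2 q.1.1.2 := by
    rintro ⟨⟨⟨s, U⟩, hU⟩, hp⟩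
    rw [mem_pieces] at hp
    obtain ⟨V, hV, h⟩ := exists_matched_right hδ hfg (hgS s hp) hU
    exact ⟨⟨⟨(s, V), hV⟩, mem_pieces.2 hp⟩, rfl, h⟩
  choose φ hφ hm using hex
  have hinj : Function.Injective φ := by
    intro p p' h
    have h1 := hφ p
    have h2 := hm p
    have h3 := hm p'
    rw [h, hφ p'] at h1
    rw [h] at h2
    obtain ⟨⟨⟨s, U⟩, hU⟩, hp⟩ := p
    obtain ⟨⟨⟨s', U'⟩, hU'⟩, hp'⟩ := p'
    simp only at h1 h2 h3 hU hU'
    subst h1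
    obtain rfl := h2.eq_left hδ hfg (hfS _ (mem_pieces.1 hp)) (comps_nonempty (φ _).1.2) hU hU' h3
    rfl
  have hsurj : Function.Surjective φ := by
    rintro ⟨⟨⟨s, V⟩, hV⟩, hq⟩
    have hs := mem_pieces.1 hq
    obtain ⟨U, hU, h⟩ := exists_matched_left hδ hfg (hfS s hs) (hgS s hs) hV
    refine ⟨⟨⟨(s, U), hU⟩, mem_pieces.2 hs⟩, ?_⟩
    have h1 := hφ ⟨⟨(s, U), hU⟩, mem_pieces.2 hs⟩
    have h2 := hm ⟨⟨(s, U), hU⟩, mem_pieces.2 hs⟩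
    generalize φ ⟨⟨(s, U), hU⟩, mem_pieces.2 hs⟩ = q at h1 h2 ⊢
    obtain ⟨⟨⟨s', V'⟩, hV'⟩, hq'⟩ := q
    simp only at h1 h2 hV' hV
    subst h1
    obtain rfl := h2.eq_right hδ (hgS _ hs) (comps_nonempty hU) hV' hV h
    rfl
  refine HeightForest.editLE_of_realizes ((pieceForest f).tree_realizes _ K hKf)
    ((pieceForest g).tree_realizes _ K hKg) (Equiv.ofBijective φ ⟨hinj, hsurj⟩) hφ fun p q => ?_
  have h1 := hφ p
  have h2 := hφ q
  show (p.1.1.1 < q.1.1.1 ∧ p.1.1.2 ⊆ q.1.1.2) ↔ ((φ p).1.1.1 < (φ q).1.1.1 ∧ _)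
  rw [h1, h2]
  refine and_congr_right fun hlt => (hm p).subset_iff hδ hfg hlt.le (hfS _ (mem_pieces.1 q.2))
    (hgS _ (mem_pieces.1 q.2)) p.1.2 ?_ q.1.2 ?_ (hm q)
  · rw [← h1]
    exact (φ p).1.2
  · rw [← h2]
    exact (φ q).1.2

/-- Above each element of `Λ` there is, within `Λ.card * η`, one that is followed by a gap of
length `η`. -/
lemma exists_gap_above (Λ : Finset ℝ) {η : ℝ} (hη : 0 ≤ η) {a : ℝ} (ha : a ∈ Λ) :
    ∃ b ∈ Λ, a ≤ b ∧ b - a ≤ Λ.card * η ∧ ∀ c ∈ Λ, c ∉ Ioc b (b + η) := by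
  suffices h : ∀ (n : ℕ) (a : ℝ), a ∈ Λ → (Λ.filter (a < ·)).card = n →
      ∃ b ∈ Λ, a ≤ b ∧ b - a ≤ n * η ∧ ∀ c ∈ Λ, c ∉ Ioc b (b + η) by
    obtain ⟨b, hb, hab, hle, hgap⟩ := h _ a ha rfl
    refine ⟨b, hb, hab, hle.trans ?_, hgap⟩
    gcongr
    exact Finset.filter_subset _ _
  intro n
  induction n using Nat.strong_induction_on with
  | _ n ih =>
    intro a ha hn
    by_cases h : ∀ c ∈ Λ, c ∉ Ioc a (a + η)
    · exact ⟨a, ha, le_rfl, by rw [sub_self]; positivity, h⟩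
    push Not at h
    obtain ⟨c, hc, hac, hca⟩ := h
    have hlt : (Λ.filter (c < ·)).card < n := by
      rw [← hn]
      refine Finset.card_lt_card (Finset.ssubset_iff_of_subset ?_ |>.2 ⟨c, ?_, ?_⟩)
      · exact fun r hr => Finset.mem_filter.2
          ⟨(Finset.mem_filter.1 hr).1, hac.trans (Finset.mem_filter.1 hr).2⟩
      · exact Finset.mem_filter.2 ⟨hc, hac⟩
      · simp
    obtain ⟨b, hb, hcb, hle, hgap⟩ := ih _ hlt c hc rfl
    refine ⟨b, hb, hac.le.trans hcb, ?_, hgap⟩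
    have h1 : (((Λ.filter (c < ·)).card : ℝ) + 1) * η ≤ n * η := by
      gcongr
      exact_mod_cast hlt
    linarith

/-- Deleting the levels outside `S`, each of which has a level of `S` at most `η` above it. -/
lemma editLE_pieces_subset (hf : ∀ t, (comps f t).Finite) {Λ S : Finset ℝ} {K η : ℝ}
    (hη : 0 ≤ η) (hSΛ : S ⊆ Λ) (hex : ∀ a ∈ Λ, ∃ b ∈ S, a ≤ b ∧ b - a ≤ η)
    (hKΛ : ∀ p ∈ pieces hf Λ, (pieceForest f).h p < K)
    (hKS : ∀ p ∈ pieces hf S, (pieceForest f).h p < K) :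
    EditLE ((pieceForest f).tree (pieces hf Λ) K hKΛ) ((pieceForest f).tree (pieces hf S) K hKS)
      ((pieces hf Λ).card * (((pieces hf Λ).card + 2) * η)) := by
  classical
  have hsub : pieces hf S ⊆ pieces hf Λ := fun p hp => mem_pieces.2 (hSΛ (mem_pieces.1 hp))
  refine (HeightForest.editLE_of_deletions hη _ _ hKΛ hKS hsub rfl ?_).mono ?_
  · rintro ⟨⟨a, U⟩, hU⟩ hp hpS
    rw [mem_pieces] at hp hpS
    obtain ⟨b, hb, hab, hle⟩ := hex a hp
    obtain ⟨V, hV, hUV⟩ := exists_comps_superset hab hU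
    exact ⟨⟨(b, V), hV⟩, mem_pieces.2 hb, ⟨hab.lt_of_ne fun h => hpS (h ▸ hb), hUV⟩, hle⟩
  · gcongr
    exact Finset.sdiff_subset

/-- Quantitative stability: the edit distance of the merge trees of two `δ`-close functions is at
most a multiple of `δ` that depends only on the number of critical values and of components. -/
theorem HasMergeTree.editLE_truncate (hf : HasMergeTree f) (hg : HasMergeTree g) {N : ℕ}
    (hfN : (criticalValues f).ncard ≤ N) (hgN : (criticalValues g).ncard ≤ N)
    (hfN' : ∀ t, (comps f t).ncard ≤ N) (hgN' : ∀ t, (comps g t).ncard ≤ N)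
    (hδ : 0 ≤ δ) (hfg : ∀ x, |f x - g x| ≤ δ) {K : ℝ} (hKf : (mergeTree f hf).IsBelow K)
    (hKg : (mergeTree g hg).IsBelow K) :
    EditLE ((mergeTree f hf).truncate K hKf) ((mergeTree g hg).truncate K hKg)
      (2 * (2 * N * N * ((2 * N * N + 2) * (2 * N * (2 * δ))))) := by
  classical
  set Λ : Finset ℝ := hf.finite_criticalValues.toFinset ∪ hg.finite_criticalValues.toFinset with hΛ
  have hfΛ : criticalValues f ⊆ Λ := fun c hc => by simp [hΛ, hc]
  have hgΛ : criticalValues g ⊆ Λ := fun c hc => by simp [hΛ, hc]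
  have hcard : Λ.card ≤ 2 * N := by
    refine (Finset.card_union_le _ _).trans ?_
    rw [← Set.ncard_eq_toFinset_card _ hf.finite_criticalValues,
      ← Set.ncard_eq_toFinset_card _ hg.finite_criticalValues]
    omega
  have hΛK : ∀ c ∈ Λ, c < K := by
    intro c hc
    rw [hΛ, Finset.mem_union, Set.Finite.mem_toFinset, Set.Finite.mem_toFinset] at hc
    rcases hc with hc | hc
    · obtain ⟨p, rfl⟩ := hf.exists_node hc
      exact WithTop.coe_lt_coe.1 (hKf (some p) (Option.some_ne_none p))
    · obtain ⟨p, rfl⟩ := hg.exists_node hc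
      exact WithTop.coe_lt_coe.1 (hKg (some p) (Option.some_ne_none p))
  -- the levels that are followed by a gap of length `2 * δ`
  set S : Finset ℝ := Λ.filter fun b => ∀ c ∈ Λ, c ∉ Ioc b (b + 2 * δ) with hS
  have hSΛ : S ⊆ Λ := Finset.filter_subset _ _
  have hex : ∀ a ∈ Λ, ∃ b ∈ S, a ≤ b ∧ b - a ≤ 2 * N * (2 * δ) := by
    intro a ha
    obtain ⟨b, hb, hab, hle, hgap⟩ := exists_gap_above Λ (by linarith : 0 ≤ 2 * δ) ha
    refine ⟨b, Finset.mem_filter.2 ⟨hb, hgap⟩, hab, hle.trans ?_⟩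
    gcongr
    exact_mod_cast hcard
  have gap : ∀ {k : X → ℝ}, HasMergeTree k → criticalValues k ⊆ Λ → ∀ b ∈ S, IsGap k δ b := by
    intro k hk hkΛ b hb s t hbs hst htb
    exact hk.inclBijective hst fun c hc hc' =>
      (Finset.mem_filter.1 hb).2 c (hkΛ hc) ⟨hbs.trans_lt hc'.1, hc'.2.trans htb⟩
  have half : ∀ {k : X → ℝ} (hk : HasMergeTree k) (hKk : (mergeTree k hk).IsBelow K),
      criticalValues k ⊆ Λ → (∀ t, (comps k t).ncard ≤ N) →
      EditLE ((mergeTree k hk).truncate K hKk) ((pieceForest k).tree (pieces hk.tame.2 S) K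
        fun p hp => hΛK _ (hSΛ (mem_pieces.1 hp)))
        (2 * N * N * ((2 * N * N + 2) * (2 * N * (2 * δ)))) := by
    intro k hk hKk hkΛ hkN
    have h1 := editLE_mergeTree_pieces hk hKk Λ hkΛ fun p hp => hΛK _ (mem_pieces.1 hp)
    have h2 := editLE_pieces_subset hk.tame.2 (by positivity : 0 ≤ 2 * (N : ℝ) * (2 * δ)) hSΛ hex
      (fun p hp => hΛK _ (mem_pieces.1 hp)) (fun p hp => hΛK _ (hSΛ (mem_pieces.1 hp)))
    refine (h1.trans h2).mono ?_
    have h3 : ((pieces hk.tame.2 Λ).card : ℝ) ≤ 2 * N * N := by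
      exact_mod_cast (card_pieces_le hkN Λ).trans (Nat.mul_le_mul_right N hcard)
    rw [zero_add]
    gcongr
  have h1 := half hf hKf hfΛ hfN'
  have h2 := half hg hKg hgΛ hgN'
  have h3 := editLE_tree_pieces hδ hfg hf.tame.2 hg.tame.2 (gap hf hfΛ) (gap hg hgΛ)
    (fun p hp => hΛK _ (hSΛ (mem_pieces.1 hp))) (fun p hp => hΛK _ (hSΛ (mem_pieces.1 hp)))
  refine ((h1.trans h3).trans h2.symm).mono ?_
  linarith

end Matching

/-! ### Piecewise monotone functions on an interval -/

section Interval

variable {α β : ℝ} {f : Icc α β → ℝ}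

/-- In an interval, points are joined inside `A` exactly if `A` contains the interval between
them. -/
lemma joinedIn_iff_uIcc_subset {A : Set (Icc α β)} {u v : Icc α β} :
    JoinedIn A u v ↔ uIcc u v ⊆ A := by
  constructor
  · rintro ⟨γ, hγ⟩
    refine Subset.trans ?_ (range_subset_iff.2 hγ)
    exact (isPreconnected_range γ.continuous).ordConnected.uIcc_subset
      ⟨0, γ.source⟩ ⟨1, γ.target⟩
  · intro h
    rw [← Topology.IsInducing.subtypeVal.joinedIn_image (h left_mem_uIcc) (h right_mem_uIcc)]
    refine JoinedIn.of_segment_subset ?_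
    rw [segment_eq_uIcc]
    intro r hr
    have hr' : r ∈ Icc α β := ordConnected_Icc.uIcc_subset u.2 v.2 hr
    refine ⟨⟨r, hr'⟩, h ?_, rfl⟩
    rw [mem_uIcc] at hr ⊢
    exact hr

lemma uIcc_subset_of_mem_comps {t : ℝ} {V : Set (Icc α β)} (hV : V ∈ comps f t)
    {u v : Icc α β} (hu : u ∈ V) (hv : v ∈ V) : uIcc u v ⊆ sublevel f t := by
  obtain ⟨x, hx, rfl⟩ := hV
  exact joinedIn_iff_uIcc_subset.1 (JoinedIn.trans (JoinedIn.symm hu) hv)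

lemma mem_comps_of_uIcc_subset {t : ℝ} {V : Set (Icc α β)} (hV : V ∈ comps f t)
    {u v : Icc α β} (hu : u ∈ V) (h : uIcc u v ⊆ sublevel f t) : v ∈ V := by
  obtain ⟨x, hx, rfl⟩ := hV
  exact JoinedIn.trans hu (joinedIn_iff_uIcc_subset.2 h)

/-- Every point outside `Y` lies between two points of `Y` between which `f` is monotone or
antitone. -/
def IsMonotonePartition (f : Icc α β → ℝ) (Y : Finset (Icc α β)) : Prop :=
  ∀ z ∉ Y, ∃ a ∈ Y, ∃ b ∈ Y, z ∈ Ioo a b ∧ (MonotoneOn f (Ioo a b) ∨ AntitoneOn f (Ioo a b))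

/-- On an interval of monotonicity, a point above level `t` that lies between two points of
`{f ≤ t}` is accompanied there by values above any `t'` smaller than the supremum: on the side where
`f` increases, the interval of monotonicity must be left before level `t` is reached again. -/
lemma exists_lt_of_lt_sSup {a b z p q : Icc α β} {t t' : ℝ} (hz : z ∈ Ioo a b)
    (hmon : MonotoneOn f (Ioo a b) ∨ AntitoneOn f (Ioo a b)) (htz : t < f z)
    (ht' : t' < sSup (f '' Ioo a b)) (hzpq : z ∈ Icc p q) (hp : f p ≤ t) (hq : f q ≤ t) :
    ∃ w ∈ Icc p q, t' < f w := by
  obtain ⟨_, ⟨v, hv, rfl⟩, htv⟩ := exists_lt_of_lt_csSup (Nonempty.image f ⟨z, hz⟩) ht'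
  rcases hmon with hmon | hmon
  · rcases le_total v z with hvz | hzv
    · exact ⟨z, hzpq, htv.trans_le (hmon hv hz hvz)⟩
    · refine ⟨v, ⟨hzpq.1.trans hzv, ?_⟩, htv⟩
      by_contra! hqv
      exact (htz.trans_le (hmon hz ⟨hz.1.trans_le hzpq.2, hqv.trans hv.2⟩ hzpq.2)).not_ge hq
  · rcases le_total z v with hzv | hvz
    · exact ⟨z, hzpq, htv.trans_le (hmon hz hv hzv)⟩
    · refine ⟨v, ⟨?_, hvz.trans hzpq.2⟩, htv⟩
      by_contra! hvp
      exact (htz.trans_le (hmon ⟨hv.1.trans hvp, hzpq.1.trans_lt hz.2⟩ hz hzpq.1)).not_ge hp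

/-- On an interval of monotonicity, one can descend from any point, without rising
first, to any level above the infimum. -/
lemma exists_le_of_sInf_lt {a b z : Icc α β} {t t' : ℝ} (hz : z ∈ Ioo a b)
    (hmon : MonotoneOn f (Ioo a b) ∨ AntitoneOn f (Ioo a b)) (hzt : f z ≤ t')
    (ht : sInf (f '' Ioo a b) < t) : ∃ u, f u ≤ t ∧ uIcc z u ⊆ sublevel f t' := by
  obtain ⟨_, ⟨v, hv, rfl⟩, hvt⟩ := exists_lt_of_csInf_lt (Nonempty.image f ⟨z, hz⟩) ht
  rcases le_or_gt (f z) t with hz' | hz'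
  · exact ⟨z, hz', by simpa [sublevel] using hzt⟩
  refine ⟨v, hvt.le, fun w hw => le_trans ?_ hzt⟩
  have hwab : w ∈ Ioo a b := ordConnected_Ioo.uIcc_subset hz hv hw
  rcases hmon with hmon | hmon
  · have hvz : v ≤ z := by
      by_contra! h
      exact (hmon hz hv h.le).not_gt (hvt.trans hz')
    rw [uIcc_of_ge hvz] at hw
    exact hmon hwab hz hw.2
  · have hzv : z ≤ v := by
      by_contra! h
      exact (hmon hv hz h.le).not_gt (hvt.trans hz')
    rw [uIcc_of_le hzv] at hw
    exact hmon hz hwab hw.1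

/-- A criterion for the inclusion `{f ≤ t} ⊆ {f ≤ t'}` to be bijective on path components: one can
descend inside `{f ≤ t'}` to level `t`, and no value at a partition point and no supremum over an
interval of monotonicity lies in `(t, t']`. -/
lemma inclBijective_of_descent {Y : Finset (Icc α β)} (hY : IsMonotonePartition f Y)
    (hbdd : BddAbove (range f)) {t t' : ℝ} (hfY : ∀ y ∈ Y, f y ∉ Ioc t t')
    (hsup : ∀ a ∈ Y, ∀ b ∈ Y, sSup (f '' Ioo a b) ∉ Ioc t t')
    (hdesc : ∀ z, t < f z → f z ≤ t' → ∃ u, f u ≤ t ∧ uIcc z u ⊆ sublevel f t') (htt' : t ≤ t') :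
    InclBijective f t t' := by
  have huniq : ∀ U V, ∀ W ∈ comps f t', U ∈ comps f t → V ∈ comps f t → U ⊆ W → V ⊆ W →
      U = V := by
    intro U V W hW hU hV hUW hVW
    obtain ⟨u, hu⟩ := comps_nonempty hU
    obtain ⟨v, hv⟩ := comps_nonempty hV
    have hut : f u ≤ t := uIcc_subset_of_mem_comps hU hu hu left_mem_uIcc
    have hvt : f v ≤ t := uIcc_subset_of_mem_comps hV hv hv left_mem_uIcc
    have huv := uIcc_subset_of_mem_comps hW (hUW hu) (hVW hv)
    refine comps_eq_of_mem hU hV (mem_comps_of_uIcc_subset hU hu fun z hz => ?_) hv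
    by_contra hzt
    have hzt : t < f z := not_le.1 hzt
    have hzY : z ∉ Y := fun h => hfY z h ⟨hzt, huv hz⟩
    obtain ⟨a, ha, b, hb, hzab, hmon⟩ := hY z hzY
    have hle : f z ≤ sSup (f '' Ioo a b) :=
      le_csSup (hbdd.mono (image_subset_range _ _)) (mem_image_of_mem f hzab)
    have hlt : t' < sSup (f '' Ioo a b) := by
      by_contra! h
      exact hsup a ha b hb ⟨hzt.trans_le hle, h⟩
    obtain ⟨w, hw, hwt⟩ := exists_lt_of_lt_sSup (p := u ⊓ v) (q := u ⊔ v) hzab hmon hzt hlt hz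
      (by rcases min_choice u v with h | h <;> rw [h] <;> assumption)
      (by rcases max_choice u v with h | h <;> rw [h] <;> assumption)
    exact absurd (huv hw) (not_le.2 hwt)
  intro W hW
  obtain ⟨z, hz⟩ := comps_nonempty hW
  have hzt' : f z ≤ t' := uIcc_subset_of_mem_comps hW hz hz left_mem_uIcc
  obtain ⟨u, hut, hu⟩ : ∃ u, f u ≤ t ∧ uIcc z u ⊆ sublevel f t' := by
    rcases le_or_gt (f z) t with h | h
    · exact ⟨z, h, by simpa [sublevel] using hzt'⟩
    · exact hdesc z h hzt'
  have huW : u ∈ W := mem_comps_of_uIcc_subset hW hz hu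
  have hU : pathComponentIn (sublevel f t) u ∈ comps f t := ⟨u, hut, rfl⟩
  have hUW : pathComponentIn (sublevel f t) u ⊆ W := by
    obtain ⟨W', hW', h⟩ := exists_comps_superset htt' hU
    rwa [comps_eq_of_mem hW hW' huW (h (mem_pathComponentIn_self hut))]
  exact ⟨_, ⟨hU, hUW⟩, fun V hV => huniq V _ W hW hV.1 hU hV.2 hUW⟩

open Classical in
/-- The values of `f` at the points of `Y`, and the infima and suprema of `f` between them. -/
noncomputable def partitionValues (f : Icc α β → ℝ) (Y : Finset (Icc α β)) : Finset ℝ :=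
  Y.image f ∪ ((Y ×ˢ Y).image (fun q => sInf (f '' Ioo q.1 q.2)) ∪
    (Y ×ˢ Y).image (fun q => sSup (f '' Ioo q.1 q.2)))

lemma card_partitionValues_le (f : Icc α β → ℝ) (Y : Finset (Icc α β)) :
    (partitionValues f Y).card ≤ Y.card + 2 * (Y.card * Y.card) := by
  classical
  have h1 := Finset.card_image_le (s := Y) (f := f)
  have h2 := Finset.card_image_le (s := Y ×ˢ Y) (f := fun q => sInf (f '' Ioo q.1 q.2))
  have h3 := Finset.card_image_le (s := Y ×ˢ Y) (f := fun q => sSup (f '' Ioo q.1 q.2))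
  rw [Finset.card_product] at h2 h3
  refine (Finset.card_union_le _ _).trans ((add_le_add_right (Finset.card_union_le _ _) _).trans ?_)
  omega

lemma mem_partitionValues {Y : Finset (Icc α β)} {y : Icc α β} (hy : y ∈ Y) :
    f y ∈ partitionValues f Y :=
  Finset.mem_union_left _ (Finset.mem_image_of_mem f hy)

lemma sInf_mem_partitionValues {Y : Finset (Icc α β)} {a b : Icc α β} (ha : a ∈ Y) (hb : b ∈ Y) :
    sInf (f '' Ioo a b) ∈ partitionValues f Y :=
  Finset.mem_union_right _ (Finset.mem_union_left _
    (Finset.mem_image.2 ⟨(a, b), Finset.mem_product.2 ⟨ha, hb⟩, rfl⟩))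

lemma sSup_mem_partitionValues {Y : Finset (Icc α β)} {a b : Icc α β} (ha : a ∈ Y) (hb : b ∈ Y) :
    sSup (f '' Ioo a b) ∈ partitionValues f Y :=
  Finset.mem_union_right _ (Finset.mem_union_right _
    (Finset.mem_image.2 ⟨(a, b), Finset.mem_product.2 ⟨ha, hb⟩, rfl⟩))

lemma IsMonotonePartition.isCriticalSet {Y : Finset (Icc α β)} (hY : IsMonotonePartition f Y)
    (ha : BddAbove (range f)) (hb : BddBelow (range f)) :
    IsCriticalSet f (partitionValues f Y) := by
  intro t t' htt' hav
  refine inclBijective_of_descent hY ha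
    (fun y hy h => hav _ (mem_partitionValues hy) (Ioc_subset_Icc_self h))
    (fun a ha b hb h => hav _ (sSup_mem_partitionValues ha hb) (Ioc_subset_Icc_self h))
    (fun z hz hz' => ?_) htt'
  have hzY : z ∉ Y := fun h => hav _ (mem_partitionValues h) ⟨hz.le, hz'⟩
  obtain ⟨a, ha, b, hb', hzab, hmon⟩ := hY z hzY
  have hle : sInf (f '' Ioo a b) ≤ f z :=
    csInf_le (hb.mono (image_subset_range _ _)) (mem_image_of_mem f hzab)
  refine exists_le_of_sInf_lt hzab hmon hz' ?_
  by_contra! h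
  exact hav _ (sInf_mem_partitionValues ha hb') ⟨h, hle.trans hz'⟩

lemma le_left_of_monotoneOn {a b w : Icc α β} (hf : Continuous f) (hmon : MonotoneOn f (Ioo a b))
    (hw : w ∈ Ioo a b) : f a ≤ f w := by
  have hsub : Ioo a w ⊆ {y | f y ≤ f w} := fun y hy =>
    hmon ⟨hy.1, hy.2.trans hw.2⟩ hw hy.2.le
  have hcl := closure_minimal hsub (isClosed_le hf continuous_const)
  rw [closure_Ioo hw.1.ne] at hcl
  exact hcl (left_mem_Icc.2 hw.1.le)

lemma le_right_of_antitoneOn {a b w : Icc α β} (hf : Continuous f) (hmon : AntitoneOn f (Ioo a b))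
    (hw : w ∈ Ioo a b) : f b ≤ f w := by
  have hsub : Ioo w b ⊆ {y | f y ≤ f w} := fun y hy =>
    hmon hw ⟨hw.1.trans hy.1, hy.2⟩ hy.1.le
  have hcl := closure_minimal hsub (isClosed_le hf continuous_const)
  rw [closure_Ioo hw.2.ne] at hcl
  exact hcl (right_mem_Icc.2 hw.2.le)

/-- For a continuous function, descending inside an interval of monotonicity leads to an endpoint,
whose value is at most the infimum; so no component is born immediately above a level. -/
lemma IsMonotonePartition.isRegular {Y : Finset (Icc α β)} (hY : IsMonotonePartition f Y)
    (ha : BddAbove (range f)) (hf : Continuous f) : IsRegular f := by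
  intro t _
  obtain ⟨η, hη, hav⟩ : ∃ η > 0, ∀ c ∈ partitionValues f Y, c ∉ Ioo t (t + η) := by
    have hmem : ((partitionValues f Y).erase t : Set ℝ)ᶜ ∈ nhds t :=
      ((partitionValues f Y).erase t).finite_toSet.isClosed.isOpen_compl.mem_nhds (by simp)
    obtain ⟨η, hη, hsub⟩ := Metric.mem_nhds_iff.1 hmem
    refine ⟨η, hη, fun c hc hc' => hsub (?_ : c ∈ Metric.ball t η) ?_⟩
    · rw [Metric.mem_ball, Real.dist_eq, abs_of_pos (by linarith [hc'.1])]
      linarith [hc'.2]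
    · simpa using ⟨hc, hc'.1.ne'⟩
  refine ⟨η, hη, fun ε hε hεη => ?_⟩
  have hav' : ∀ c ∈ partitionValues f Y, c ∉ Ioc t (t + ε) := fun c hc hc' =>
    hav c hc ⟨hc'.1, hc'.2.trans_lt (by linarith)⟩
  refine inclBijective_of_descent hY ha (fun y hy => hav' _ (mem_partitionValues hy))
    (fun a ha b hb => hav' _ (sSup_mem_partitionValues ha hb)) (fun z hz hz' => ?_) (by linarith)
  have hzY : z ∉ Y := fun h => hav' _ (mem_partitionValues h) ⟨hz, hz'⟩
  obtain ⟨a, ha, b, hb, hzab, hmon | hmon⟩ := hY z hzY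
  · have haz := le_left_of_monotoneOn hf hmon hzab
    refine ⟨a, ?_, fun w hw => ?_⟩
    · by_contra! h
      exact hav' _ (mem_partitionValues ha) ⟨h, haz.trans hz'⟩
    · rw [uIcc_of_ge hzab.1.le] at hw
      rcases hw.1.eq_or_lt with rfl | haw
      · exact haz.trans hz'
      · exact (hmon ⟨haw, hw.2.trans_lt hzab.2⟩ hzab hw.2).trans hz'
  · have hbz := le_right_of_antitoneOn hf hmon hzab
    refine ⟨b, ?_, fun w hw => ?_⟩
    · by_contra! h
      exact hav' _ (mem_partitionValues hb) ⟨h, hbz.trans hz'⟩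
    · rw [uIcc_of_le hzab.2.le] at hw
      rcases hw.2.eq_or_lt with rfl | hwb
      · exact hbz.trans hz'
      · exact (hmon hzab ⟨hzab.1.trans_le hw.1, hwb⟩ hw.1).trans hz'

lemma IsMonotonePartition.comps_finite {Y : Finset (Icc α β)} (hY : IsMonotonePartition f Y)
    (t : ℝ) : (comps f t).Finite ∧ (comps f t).ncard ≤ Y.card + Y.card * Y.card := by
  classical
  -- a component contains a point of `Y` or is determined by an interval that it meets
  set P : Finset (Set (Icc α β)) := Y.image (pathComponentIn (sublevel f t)) ∪
    (Y ×ˢ Y).image (fun q => if h : ∃ x ∈ Ioo q.1 q.2, f x ≤ t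
      then pathComponentIn (sublevel f t) h.choose else ∅) with hP
  have hsub : comps f t ⊆ P := by
    rintro _ ⟨x, hx, rfl⟩
    rw [hP, Finset.mem_coe, Finset.mem_union]
    by_cases hxY : x ∈ Y
    · exact Or.inl (Finset.mem_image_of_mem _ hxY)
    obtain ⟨a, ha, b, hb, hxab, hmon⟩ := hY x hxY
    refine Or.inr (Finset.mem_image.2 ⟨(a, b), Finset.mem_product.2 ⟨ha, hb⟩, ?_⟩)
    have h : ∃ x ∈ Ioo a b, f x ≤ t := ⟨x, hxab, hx⟩
    rw [dif_pos h]
    obtain ⟨hy, hyt⟩ := h.choose_spec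
    refine pathComponentIn_congr (joinedIn_iff_uIcc_subset.2 fun w hw => ?_)
    have hw' : w ∈ Ioo a b := ordConnected_Ioo.uIcc_subset hxab hy hw
    rcases hmon with hmon | hmon
    · rcases max_choice x h.choose with h' | h'
      · exact (hmon hw' hxab (h' ▸ hw.2)).trans hx
      · exact (hmon hw' hy (h' ▸ hw.2)).trans hyt
    · rcases min_choice x h.choose with h' | h'
      · exact (hmon hxab hw' (h' ▸ hw.1)).trans hx
      · exact (hmon hy hw' (h' ▸ hw.1)).trans hyt
  refine ⟨P.finite_toSet.subset hsub, (Set.ncard_le_ncard hsub P.finite_toSet).trans ?_⟩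
  rw [Set.ncard_coe_finset]
  refine (Finset.card_union_le _ _).trans (add_le_add Finset.card_image_le ?_)
  exact Finset.card_image_le.trans (Finset.card_product _ _).le

end Interval

/-! ### Piecewise polynomial functions -/

section PiecewisePolynomial

variable {n d : ℕ} {x : Fin (n + 1) → ℝ} {f : Icc (x 0) (x (Fin.last n)) → ℝ}

lemma knot_mem_Icc (hx : StrictMono x) (i : Fin (n + 1)) : x i ∈ Icc (x 0) (x (Fin.last n)) :=
  ⟨hx.monotone (Fin.zero_le i), hx.monotone (Fin.le_last i)⟩

lemma exists_mem_Ioo_of_ne_knot {z : ℝ} (hz : z ∈ Icc (x 0) (x (Fin.last n)))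
    (hne : ∀ i, z ≠ x i) : ∃ i : Fin n, z ∈ Ioo (x i.castSucc) (x i.succ) := by
  classical
  obtain ⟨i, hi, hmax⟩ := Finset.exists_max_image (Finset.univ.filter fun i => x i ≤ z) id
    ⟨0, Finset.mem_filter.2 ⟨Finset.mem_univ _, hz.1⟩⟩
  have hi := (Finset.mem_filter.1 hi).2
  induction i using Fin.lastCases with
  | last => exact absurd (hz.2.antisymm hi) (hne _)
  | cast j =>
    refine ⟨j, hi.lt_of_ne (hne _).symm, ?_⟩
    by_contra! h
    have := hmax j.succ (Finset.mem_filter.2 ⟨Finset.mem_univ _, h⟩)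
    exact absurd this (not_le.2 (Fin.castSucc_lt_succ))

lemma IsPiecewisePolynomial.isBounded (hf : IsPiecewisePolynomial x d f) :
    BddAbove (range f) ∧ BddBelow (range f) := by
  choose p _ hp using hf
  have hK : IsCompact ((f '' {y | ∃ i, (y : ℝ) = x i}) ∪
      ⋃ i : Fin n, (p i).eval '' Icc (x i.castSucc) (x i.succ)) := by
    refine IsCompact.union (Set.Finite.isCompact (Set.Finite.image f ?_)) (isCompact_iUnion fun i =>
      isCompact_Icc.image (p i).continuous)
    refine ((finite_range x).preimage Subtype.val_injective.injOn).subset ?_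
    rintro y ⟨i, hi⟩
    exact ⟨i, hi.symm⟩
  have hsub : range f ⊆ (f '' {y | ∃ i, (y : ℝ) = x i}) ∪
      ⋃ i : Fin n, (p i).eval '' Icc (x i.castSucc) (x i.succ) := by
    rintro _ ⟨y, rfl⟩
    by_cases hy : ∃ i, (y : ℝ) = x i
    · exact Or.inl ⟨y, hy, rfl⟩
    · push Not at hy
      obtain ⟨i, hi⟩ := exists_mem_Ioo_of_ne_knot y.2 hy
      exact Or.inr (mem_iUnion.2 ⟨i, y, Ioo_subset_Icc_self hi, (hp i y hi).symm⟩)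
  exact ⟨hK.bddAbove.mono hsub, hK.bddBelow.mono hsub⟩

/-- A polynomial is monotone between consecutive zeros of its derivative. -/
lemma polynomial_monotoneOn_or_antitoneOn (p : Polynomial ℝ) {a b : ℝ}
    (h : p.derivative = 0 ∨ ∀ r ∈ Ioo a b, p.derivative.eval r ≠ 0) :
    MonotoneOn (fun r => p.eval r) (Ioo a b) ∨ AntitoneOn (fun r => p.eval r) (Ioo a b) := by
  have hsign : (∀ r ∈ Ioo a b, 0 ≤ p.derivative.eval r) ∨
      ∀ r ∈ Ioo a b, p.derivative.eval r ≤ 0 := by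
    rcases h with h | h
    · left
      simp [h]
    · rcases hasDerivWithinAt_forall_lt_or_forall_gt_of_forall_ne (convex_Ioo a b)
        (fun r _ => p.hasDerivWithinAt r (Ioo a b)) h with h | h
      · exact Or.inr fun r hr => (h r hr).le
      · exact Or.inl fun r hr => (h r hr).le
  refine hsign.imp (fun h => ?_) fun h => ?_
  · refine monotoneOn_of_deriv_nonneg (convex_Ioo a b) p.continuous.continuousOn
      p.differentiable.differentiableOn fun r hr => ?_
    rw [interior_Ioo] at hr
    rw [Polynomial.deriv]
    exact h r hr
  · refine antitoneOn_of_deriv_nonpos (convex_Ioo a b) p.continuous.continuousOn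
      p.differentiable.differentiableOn fun r hr => ?_
    rw [interior_Ioo] at hr
    rw [Polynomial.deriv]
    exact h r hr

/-- The knots and the zeros of the derivatives cut the interval into intervals of monotonicity;
their number is bounded in terms of the number of knots and the degree. -/
lemma IsPiecewisePolynomial.exists_isMonotonePartition (hx : StrictMono x)
    (hf : IsPiecewisePolynomial x d f) :
    ∃ Y, IsMonotonePartition f Y ∧ Y.card ≤ n + 1 + n * d := by
  classical
  choose p hd hp using hf
  set Y : Finset (Icc (x 0) (x (Fin.last n))) :=
    Finset.univ.image (fun i => ⟨x i, knot_mem_Icc hx i⟩) ∪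
      Finset.univ.biUnion fun i => (p i).derivative.roots.toFinset.subtype
        (· ∈ Icc (x 0) (x (Fin.last n))) with hY
  refine ⟨Y, fun z hz => ?_, ?_⟩
  · have hknot : ∀ i, (⟨x i, knot_mem_Icc hx i⟩ : Icc (x 0) (x (Fin.last n))) ∈ Y := fun i =>
      Finset.mem_union_left _ (Finset.mem_image_of_mem _ (Finset.mem_univ i))
    obtain ⟨i, hi⟩ := exists_mem_Ioo_of_ne_knot z.2 fun i h => hz (by
      have := hknot i
      simpa only [← h] using this)
    obtain ⟨a, ha, hamax⟩ := Finset.exists_max_image (Y.filter (· < z)) id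
      ⟨_, Finset.mem_filter.2 ⟨hknot i.castSucc, hi.1⟩⟩
    obtain ⟨b, hb, hbmin⟩ := Finset.exists_min_image (Y.filter (z < ·)) id
      ⟨_, Finset.mem_filter.2 ⟨hknot i.succ, hi.2⟩⟩
    rw [Finset.mem_filter] at ha hb
    have hia : x i.castSucc ≤ a := hamax _ (Finset.mem_filter.2 ⟨hknot i.castSucc, hi.1⟩)
    have hib : (b : ℝ) ≤ x i.succ := hbmin _ (Finset.mem_filter.2 ⟨hknot i.succ, hi.2⟩)
    have hno : ∀ y ∈ Y, y ∉ Ioo a b := by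
      intro y hy hyab
      rcases lt_trichotomy y z with h | h | h
      · exact absurd (hamax y (Finset.mem_filter.2 ⟨hy, h⟩)) (not_le.2 hyab.1)
      · exact hz (h ▸ hy)
      · exact absurd (hbmin y (Finset.mem_filter.2 ⟨hy, h⟩)) (not_le.2 hyab.2)
    have hmon := polynomial_monotoneOn_or_antitoneOn (p i) (a := a) (b := b) (by
      by_cases h0 : (p i).derivative = 0
      · exact Or.inl h0
      · refine Or.inr fun r hr hr0 => ?_
        have hrI : r ∈ Icc (x 0) (x (Fin.last n)) :=
          ⟨a.2.1.trans hr.1.le, hr.2.le.trans b.2.2⟩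
        refine hno ⟨r, hrI⟩ (Finset.mem_union_right _ (Finset.mem_biUnion.2
          ⟨i, Finset.mem_univ _, ?_⟩)) hr
        rw [Finset.mem_subtype, Multiset.mem_toFinset, Polynomial.mem_roots h0]
        exact hr0)
    have hfp : ∀ y ∈ Ioo a b, f y = (p i).eval (y : ℝ) := fun y hy =>
      hp i y ⟨hia.trans_lt hy.1, lt_of_lt_of_le hy.2 hib⟩
    refine ⟨a, ha.1, b, hb.1, ⟨ha.2, hb.2⟩, hmon.imp (fun h u hu v hv huv => ?_)
      fun h u hu v hv huv => ?_⟩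
    · rw [hfp u hu, hfp v hv]
      exact h hu hv huv
    · rw [hfp u hu, hfp v hv]
      exact h hu hv huv
  · refine (Finset.card_union_le _ _).trans (add_le_add ?_ ?_)
    · exact Finset.card_image_le.trans (by simp)
    · refine (Finset.card_biUnion_le_card_mul _ _ d fun i _ => ?_).trans (by simp)
      rw [Finset.card_subtype]
      refine (Finset.card_filter_le _ _).trans ((Multiset.toFinset_card_le _).trans ?_)
      refine (Polynomial.card_roots' _).trans ((Polynomial.natDegree_derivative_le _).trans ?_)
      have := hd i
      omega

/-- The number of critical values and of components is bounded uniformly over all piecewise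
polynomial functions with given numbers of knots and degree. -/
lemma IsPiecewisePolynomial.exists_bound (n d : ℕ) : ∃ N : ℕ, ∀ (x : Fin (n + 1) → ℝ),
    StrictMono x → ∀ f : Icc (x 0) (x (Fin.last n)) → ℝ, IsPiecewisePolynomial x d f →
      (criticalValues f).ncard ≤ N ∧ ∀ t, (comps f t).ncard ≤ N := by
  refine ⟨(n + 1 + n * d) + 2 * ((n + 1 + n * d) * (n + 1 + n * d)), fun x hx f hf => ?_⟩
  obtain ⟨Y, hY, hcard⟩ := hf.exists_isMonotonePartition hx
  have hsq := Nat.mul_le_mul hcard hcard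
  obtain ⟨ha, hb⟩ := hf.isBounded
  constructor
  · have hsub : criticalValues f ⊆ partitionValues f Y := fun t ht => ht _ (hY.isCriticalSet ha hb)
    refine (Set.ncard_le_ncard hsub (Finset.finite_toSet _)).trans ?_
    rw [Set.ncard_coe_finset]
    have := card_partitionValues_le f Y
    omega
  · intro t
    have := (hY.comps_finite t).2
    omega

lemma IsPiecewisePolynomial.hasMergeTree (hx : StrictMono x) (hf : IsPiecewisePolynomial x d f)
    (hreg : Continuous f ∨ IsRegular f) : HasMergeTree f := by
  obtain ⟨Y, hY, -⟩ := hf.exists_isMonotonePartition hx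
  obtain ⟨ha, hb⟩ := hf.isBounded
  exact
    { pathConnected := isPathConnected_iff_pathConnectedSpace.1
        ((convex_Icc _ _).isPathConnected ⟨x 0, knot_mem_Icc hx 0⟩)
      tame := ⟨⟨_, hY.isCriticalSet ha hb⟩, fun t => (hY.comps_finite t).1⟩
      regular := hreg.elim (hY.isRegular ha) id
      bddAbove := ha
      bddBelow := hb }

end PiecewisePolynomial

end MergeTrees

theorem mainTheorem6 (n d : ℕ) (x : Fin (n + 1) → ℝ) (hx : StrictMono x)
    (S : Set (Set.Icc (x 0) (x (Fin.last n)) → ℝ))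
    (hS : ∀ f ∈ S, MergeTrees.IsPiecewisePolynomial x d f)
    (hreg : ∀ f ∈ S, Continuous f ∨ MergeTrees.IsRegular f) :
    ∃ hT : ∀ f ∈ S, MergeTrees.HasMergeTree f,
      ∀ f, ∀ hf : f ∈ S, ∀ ε : ENNReal, 0 < ε → ∃ δ : ℝ, 0 < δ ∧
        ∀ g, ∀ hg : g ∈ S, (∀ y, |f y - g y| < δ) →
          ∀ (K : ℝ) (hKf : (MergeTrees.mergeTree f (hT f hf)).IsBelow K)
            (hKg : (MergeTrees.mergeTree g (hT g hg)).IsBelow K),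
            MergeTrees.editDist
              ((MergeTrees.mergeTree f (hT f hf)).truncate K hKf)
              ((MergeTrees.mergeTree g (hT g hg)).truncate K hKg) < ε := by
  refine ⟨fun f hf => (hS f hf).hasMergeTree hx (hreg f hf), fun f hf ε hε => ?_⟩
  obtain ⟨N, hN⟩ := MergeTrees.IsPiecewisePolynomial.exists_bound n d
  obtain ⟨r, hr, hrε⟩ := ENNReal.lt_iff_exists_nnreal_btwn.1 hε
  have hr : 0 < (r : ℝ) := by exact_mod_cast hr
  -- the edit distance is at most `B * δ`
  set B : ℝ := 2 * (2 * N * N * ((2 * N * N + 2) * (2 * N * 2))) with hB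
  have hB0 : 0 ≤ B := by positivity
  refine ⟨r / (B + 1), by positivity, fun g hg hfg K hKf hKg => ?_⟩
  have h := MergeTrees.HasMergeTree.editLE_truncate ((hS f hf).hasMergeTree hx (hreg f hf))
    ((hS g hg).hasMergeTree hx (hreg g hg)) (hN x hx f (hS f hf)).1 (hN x hx g (hS g hg)).1
    (hN x hx f (hS f hf)).2 (hN x hx g (hS g hg)).2 (by positivity : 0 ≤ (r : ℝ) / (B + 1))
    (fun y => (hfg y).le) hKf hKg
  refine (h.editDist_le.trans ?_).trans_lt hrε
  rw [← ENNReal.ofReal_coe_nnreal]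
  refine ENNReal.ofReal_le_ofReal ?_
  calc _ = B * (r / (B + 1)) := by rw [hB]; ring
    _ ≤ (B + 1) * (r / (B + 1)) := by gcongr; linarith
    _ = r := by field_simp
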